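/- **Conventions.** All vector spaces are over $\mathbb{C}$. A vertex algebra is a vector space $V$ with a vacuum vector $\mathbf 1$ and bilinear products $a_{(n)}b$ ($n\in\mathbb{Z}$), with $a_{(n)}b=0$ for $n\gg0$, satisfying the vacuum and creation axioms and the Borcherds identity. An automorphism of $V$ is an invertible linear operator $\varphi$ with $\varphi(a_{(n)}b)=(\varphi a)_{(n)}(\varphi b)$ for all $a,b,n$. It is locally finite if every $a\in V$ lies in a finite-dimensional $\varphi$-invariant subspace. In that case $\varphi=\sigma e^{-2\pi i\mathcal N}$ for unique $\sigma,\mathcal N$ with $\sigma$ semisimple (diagonalizable), $\mathcal N$ locally nilpotent and $\sigma\mathcal N=\mathcal N\sigma$. For $\alpha\in\mathbb{C}/\mathbb{Z}$ put $V_\alpha=\{a\in V:\sigma a=e^{-2\pi i\alpha}a\}$. Let $z,z_1,z_2$ be formal variables, with further formal variables $\zeta,\zeta_1,\zeta_2$ playing the role of their logarithms. Put $z_{12}=z_1-z_2$, $D_z=\partial_z+z^{-1}\partial_\zeta$, $D_\zeta=z\partial_z+\partial_\zeta$ (similarly for $z_1,z_2$), and $D^{(j)}=D^j/j!$. The operator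 $e^{2\pi iD_\zeta}$ sends $\zeta\mapsto\zeta+2\pi i$ and $z^\gamma\mapsto e^{2\pi i\gamma}z^\gamma$. For a vector space $W$ and $\alpha\in\mathbb{C}/\mathbb{Z}$ let $W[\zeta][[z]]z^{-\alpha}$ be the space of series $\sum_{i\ge0}w_i(\zeta)z^{i-m}$ with $w_i(\zeta)\in W[\zeta]$, $m\in\alpha$. The space of logarithmic fields on $W$ is $$\mathrm{LF}(W)=\bigoplus_{\alpha\in\mathbb{C}/\mathbb{Z}}\mathrm{Hom}_{\mathbb C}\bigl(W,W[\zeta][[z]]z^{-\alpha}\bigr).$$ A pair $a,b\in\mathrm{LF}(W)$ is local if $z_{12}^N a(z_1)b(z_2)=z_{12}^N b(z_2)a(z_1)$ for some integer $N\ge0$. For a local pair and $n\in\mathbb{Z}$, the $n$-th product $a_{(n)}b$ is defined by $$(a_{(n)}b)(z)v=D_{z_1}^{(N-1-n)}\bigl(z_{12}^N a(z_1)b(z_2)v\bigr)\big|_{z_1=z_2=z,\ \zeta_1=\zeta_2=\zeta}\quad(v\in W,\ n\le N-1),$$ and $a_{(n)}b=0$ for $n\ge N$; this does not depend on the choice of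 $N$. A $\varphi$-twisted $V$-module is a vector space $W$ with a linear map $Y\colon V\to\mathrm{LF}(W)$ such that 1. $Y(\mathbf 1)=I$, the identity operator; 2. every pair of fields in $Y(V)$ is local; 3. ($\varphi$-equivariance) $Y(\varphi a,z)=e^{2\pi iD_\zeta}Y(a,z)$ for all $a\in V$; 4. ($n$-th product identity) $Y(a_{(n)}b,z)=Y(a,z)_{(n)}Y(b,z)$ for all $a,b\in V$, $n\in\mathbb{Z}$. For $\alpha\in\mathbb{C}/\mathbb{Z}$ let $$\delta_{\alpha+\mathcal N}(z_1,z_2)=\sum_{m\in\alpha}z_1^{-m-1}z_2^m\,e^{(\zeta_2-\zeta_1)\mathcal N}.$$ For $n\in\mathbb{Z}$ let $\iota_{z_1,z_2}z_{12}^n=\sum_{i\ge0}(-1)^i\binom ni z_1^{n-i}z_2^i$ and $\iota_{z_2,z_1}z_{12}^n=\sum_{i\ge0}(-1)^{n+i}\binom ni z_1^iz_2^{n-i}$. **Proposition.** Let $V$ be a vertex algebra, $\varphi$ a locally finite automorphism of $V$, $W$ a vector space, and $Y\colon V\to\mathrm{LF}(W)$ a linear map which satisfies the $\varphi$-equivariance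 (3) and the Borcherds identity $$\iota_{z_1,z_2}z_{12}^n\,Y(a,z_1)Y(b,z_2)v-\iota_{z_2,z_1}z_{12}^n\,Y(b,z_2)Y(a,z_1)v=\sum_{j=0}^\infty Y\Bigl(\bigl(D_{z_2}^{(j)}\delta_{\alpha+\mathcal N}(z_1,z_2)a\bigr)_{(n+j)}b,z_2\Bigr)v$$ for all $\alpha\in\mathbb{C}/\mathbb{Z}$, $a\in V_\alpha$, $b\in V$, $v\in W$, $n\in\mathbb{Z}$. Then every pair of fields in $Y(V)$ is local and the $n$-th product identity (4) holds. Consequently, if moreover $Y(\mathbf 1)=I$, then $W$ is a $\varphi$-twisted $V$-module. -/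

import Mathlib

open scoped BigOperators

namespace TwistedModules

/-! ### Vertex algebras -/

/-- A vertex algebra over `ℂ`: a vector space with a vacuum vector and bilinear products
`a_(n) b` (`n ∈ ℤ`), i.e. `Y(a, z) = ∑ a_(n) z^(-n-1)`, satisfying the field (truncation)
property, the vacuum and creation axioms and the Borcherds identity. All sums are finite by
truncation. -/
class VertexAlgebra (V : Type*) [AddCommGroup V] [Module ℂ V] where
  /-- the vacuum vector -/
  vac : V
  /-- `prod n a b` is `a_(n) b` -/
  prod : ℤ → V →ₗ[ℂ] V →ₗ[ℂ] V
  truncation : ∀ a b : V, ∃ L : ℤ, ∀ n : ℤ, L ≤ n → prod n a b = 0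
  vac_prod : ∀ (n : ℤ) (a : V), prod n vac a = if n = -1 then a else 0
  prod_vac : ∀ a : V, prod (-1) a vac = a
  prod_vac_of_nonneg : ∀ (a : V) (n : ℤ), 0 ≤ n → prod n a vac = 0
  borcherds : ∀ (a b c : V) (m n k : ℤ),
    (∑ᶠ i : ℕ, ((-1 : ℂ) ^ i * (Ring.choose n i : ℂ)) •
        (prod (m + n - i) a (prod (k + i) b c)
          - (-1 : ℂ) ^ n • prod (k + n - i) b (prod (m + i) a c)))
      = ∑ᶠ j : ℕ, (Ring.choose m j : ℂ) • prod (m + k - j) (prod (n + j) a b) c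

/-- An invertible linear operator preserving all `n`-th products. -/
def IsAutomorphism {V : Type*} [AddCommGroup V] [Module ℂ V] [VertexAlgebra V]
    (φ : V ≃ₗ[ℂ] V) : Prop :=
  ∀ (a b : V) (n : ℤ),
    φ (VertexAlgebra.prod n a b) = VertexAlgebra.prod n (φ a) (φ b)

/-! ### Locally finite operators and the decomposition `φ = σ e^{-2πi𝒩}` -/

section LinearAlgebra

variable {V : Type*} [AddCommGroup V] [Module ℂ V]

/-- Every vector lies in a finite-dimensional invariant subspace. -/
def IsLocallyFinite (φ : Module.End ℂ V) : Prop :=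
  ∀ a : V, ∃ U : Submodule ℂ V, FiniteDimensional ℂ U ∧ a ∈ U ∧ ∀ u ∈ U, φ u ∈ U

/-- Every vector is killed by a power of the operator. -/
def IsLocallyNilpotent (𝒩 : Module.End ℂ V) : Prop :=
  ∀ a : V, ∃ l : ℕ, (𝒩 ^ l) a = 0

/-- `e^{c𝒩} a` for a locally nilpotent operator `𝒩` (the sum is then finite). -/
noncomputable def expApply (c : ℂ) (𝒩 : Module.End ℂ V) (a : V) : V :=
  ∑ᶠ l : ℕ, (c ^ l / (l.factorial : ℂ)) • (𝒩 ^ l) a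

/-- `φ = σ e^{-2πi𝒩}` with `σ` semisimple (i.e. diagonalizable, the ground field being `ℂ`),
`𝒩` locally nilpotent and `σ𝒩 = 𝒩σ`. Every invertible locally finite operator `φ` has exactly
one such decomposition. -/
structure IsJordanDecomposition (φ σ 𝒩 : Module.End ℂ V) : Prop where
  semisimple : ⨆ μ : ℂ, σ.eigenspace μ = ⊤
  locallyNilpotent : IsLocallyNilpotent 𝒩
  commute : Commute σ 𝒩
  decomposition : ∀ a : V, φ a = σ (expApply (-(2 * Real.pi * Complex.I)) 𝒩 a)

/-- The eigenspace `V_α = {a | σ a = e^{-2πiα} a}`. Here and below a coset in `ℂ/ℤ` is given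
by a complex number representing it. -/
noncomputable def sigmaSpace (σ : Module.End ℂ V) (α : ℂ) : Submodule ℂ V :=
  σ.eigenspace (Complex.exp (-(2 * Real.pi * Complex.I * α)))

end LinearAlgebra

/-! ### Formal series in `z, ζ` and in `z₁, z₂, ζ₁, ζ₂` -/

section Series

variable (W : Type*)

/-- Formal sums `∑ f γ k z^γ ζ^k` over `γ ∈ ℂ`, `k ∈ ℕ`, with coefficients in `W`. -/
abbrev LogSeries := ℂ → ℕ → W

/-- Formal sums `∑ f γ₁ γ₂ k₁ k₂ z₁^γ₁ z₂^γ₂ ζ₁^k₁ ζ₂^k₂` with coefficients in `W`. -/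
abbrev LogSeries₂ := ℂ → ℂ → ℕ → ℕ → W

variable {W} [AddCommGroup W] [Module ℂ W]

/-- The subspace `W[ζ][[z]] z^{-α}`: polynomials in `ζ` as coefficients of powers `z^{i-m}`,
`i ∈ ℕ`, for some `m ∈ α + ℤ`. -/
def polySeries (W : Type*) [AddCommGroup W] [Module ℂ W] (α : ℂ) :
    Submodule ℂ (LogSeries W) where
  carrier := {f | (∀ γ : ℂ, ∃ d : ℕ, ∀ k : ℕ, d ≤ k → f γ k = 0) ∧
    ∃ j : ℤ, ∀ γ : ℂ, f γ ≠ 0 → ∃ i : ℕ, γ = i - (α + j)}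
  zero_mem' := ⟨fun _ => ⟨0, fun _ _ => rfl⟩, 0, fun _ h => absurd rfl h⟩
  add_mem' := by
    rintro f g ⟨hf, j, hj⟩ ⟨hg, j', hj'⟩
    refine ⟨fun γ => ?_, max j j', fun γ h => ?_⟩
    · obtain ⟨d, hd⟩ := hf γ
      obtain ⟨d', hd'⟩ := hg γ
      refine ⟨max d d', fun k hk => ?_⟩
      simp [hd k (le_trans (le_max_left _ _) hk), hd' k (le_trans (le_max_right _ _) hk)]
    · have key : ∀ (l : ℤ), l ≤ max j j' → (∃ i : ℕ, γ = i - (α + l)) →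
          ∃ i : ℕ, γ = i - (α + (max j j' : ℤ)) := by
        rintro l hl ⟨i, rfl⟩
        obtain ⟨e, he⟩ := Int.eq_ofNat_of_zero_le (sub_nonneg.2 hl)
        have he' : ((max j j' : ℤ) : ℂ) = e + l := by
          have : (max j j' : ℤ) = e + l := by omega
          rw [this]; push_cast; ring
        exact ⟨i + e, by rw [he']; push_cast; ring⟩
      by_cases h0 : f γ = 0
      · exact key j' (le_max_right _ _) (hj' γ (by simpa [h0] using h))
      · exact key j (le_max_left _ _) (hj γ h0)
  smul_mem' := by
    rintro c f ⟨hf, j, hj⟩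
    refine ⟨fun γ => ?_, j, fun γ h => hj γ fun h0 => h (by simp [h0])⟩
    obtain ⟨d, hd⟩ := hf γ
    exact ⟨d, fun k hk => by simp [hd k hk]⟩

/-- `LF_α(W) = Hom(W, W[ζ][[z]] z^{-α})`. -/
def LFcomp (W : Type*) [AddCommGroup W] [Module ℂ W] (α : ℂ) :
    Submodule ℂ (W →ₗ[ℂ] LogSeries W) where
  carrier := {a | ∀ v : W, a v ∈ polySeries W α}
  zero_mem' := fun _ => Submodule.zero_mem _
  add_mem' := fun ha hb v => Submodule.add_mem _ (ha v) (hb v)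
  smul_mem' := fun c _ ha v => Submodule.smul_mem _ c (ha v)

/-- The space `LF(W)` of logarithmic fields: finite sums of elements of the `LF_α(W)`.
(`LF_α(W)` depends only on `α + ℤ`, and the sum over cosets is direct, since different cosets
involve disjoint sets of powers of `z`.) -/
def LF (W : Type*) [AddCommGroup W] [Module ℂ W] : Submodule ℂ (W →ₗ[ℂ] LogSeries W) :=
  ⨆ α : ℂ, LFcomp W α

/-- The constant field `I`, the identity operator `v ↦ v z^0 ζ^0`. -/
noncomputable def idField (W : Type*) [AddCommGroup W] [Module ℂ W] :
    W →ₗ[ℂ] LogSeries W :=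
  (LinearMap.single ℂ (fun _ : ℂ => ℕ → W) 0).comp (LinearMap.single ℂ (fun _ : ℕ => W) 0)

/-- The monodromy operator `e^{2πi D_ζ}`, `D_ζ = z∂_z + ∂_ζ`. On the coefficient of `z^γ` the
operator `D_ζ` acts as `γ + ∂_ζ`, so its exponential multiplies by `e^{2πiγ}` and replaces
`ζ` by `ζ + 2πi`. The sum is finite on polynomials in `ζ`. -/
noncomputable def monodromy (f : LogSeries W) : LogSeries W := fun γ k =>
  Complex.exp (2 * Real.pi * Complex.I * γ) •
    ∑ᶠ l : ℕ, (((k + l).choose k : ℂ) * (2 * Real.pi * Complex.I) ^ l) • f γ (k + l)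

/-- Multiplication by `z₁₂ = z₁ - z₂`. -/
def mulZ12 : Module.End ℂ (LogSeries₂ W) where
  toFun f := fun γ₁ γ₂ k₁ k₂ => f (γ₁ - 1) γ₂ k₁ k₂ - f γ₁ (γ₂ - 1) k₁ k₂
  map_add' f g := by
    funext γ₁ γ₂ k₁ k₂
    simp only [Pi.add_apply]
    abel
  map_smul' c f := by
    funext γ₁ γ₂ k₁ k₂
    simp [smul_sub]

/-- The derivation `D_{z₁} = ∂_{z₁} + z₁⁻¹ ∂_{ζ₁}`. -/
def Dz1 : Module.End ℂ (LogSeries₂ W) where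
  toFun f := fun γ₁ γ₂ k₁ k₂ =>
    (γ₁ + 1) • f (γ₁ + 1) γ₂ k₁ k₂ + ((k₁ : ℂ) + 1) • f (γ₁ + 1) γ₂ (k₁ + 1) k₂
  map_add' f g := by
    funext γ₁ γ₂ k₁ k₂
    simp only [Pi.add_apply, smul_add]
    abel
  map_smul' c f := by
    funext γ₁ γ₂ k₁ k₂
    simp only [Pi.smul_apply, smul_add, RingHom.id_apply, smul_comm c]

/-- The derivation `D_{z₂} = ∂_{z₂} + z₂⁻¹ ∂_{ζ₂}`. -/
def Dz2 : Module.End ℂ (LogSeries₂ W) where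
  toFun f := fun γ₁ γ₂ k₁ k₂ =>
    (γ₂ + 1) • f γ₁ (γ₂ + 1) k₁ k₂ + ((k₂ : ℂ) + 1) • f γ₁ (γ₂ + 1) k₁ (k₂ + 1)
  map_add' f g := by
    funext γ₁ γ₂ k₁ k₂
    simp only [Pi.add_apply, smul_add]
    abel
  map_smul' c f := by
    funext γ₁ γ₂ k₁ k₂
    simp only [Pi.smul_apply, smul_add, RingHom.id_apply, smul_comm c]

/-- Divided powers `D^{(j)} = D^j / j!`. -/
noncomputable def divPow {M : Type*} [AddCommGroup M] [Module ℂ M] (D : Module.End ℂ M)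
    (j : ℕ) : Module.End ℂ M :=
  ((j.factorial : ℂ)⁻¹) • D ^ j

/-- Setting `z₁ = z₂ = z`, `ζ₁ = ζ₂ = ζ`. For the series to which this is applied, the sum
is finite. -/
noncomputable def diag (f : LogSeries₂ W) : LogSeries W := fun γ k =>
  ∑ᶠ γ₁ : ℂ, ∑ p ∈ Finset.HasAntidiagonal.antidiagonal k, f γ₁ (γ - γ₁) p.1 p.2

/-- `a(z₁) b(z₂) v`. -/
def comp12 (a b : W →ₗ[ℂ] LogSeries W) (v : W) : LogSeries₂ W :=
  fun γ₁ γ₂ k₁ k₂ => a (b v γ₂ k₂) γ₁ k₁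

/-- `b(z₂) a(z₁) v`. -/
def comp21 (a b : W →ₗ[ℂ] LogSeries W) (v : W) : LogSeries₂ W :=
  fun γ₁ γ₂ k₁ k₂ => b (a v γ₁ k₁) γ₂ k₂

/-- Multiplication by
`ι_{z₁,z₂} z₁₂^n = ∑_{i ≥ 0} (-1)^i (n choose i) z₁^{n-i} z₂^i`. It is applied to
`a(z₁) b(z₂) v`, where each coefficient of the result is a finite sum. -/
noncomputable def iota12 (n : ℤ) (f : LogSeries₂ W) : LogSeries₂ W :=
  fun γ₁ γ₂ k₁ k₂ => ∑ᶠ i : ℕ,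
    ((-1 : ℂ) ^ i * (Ring.choose n i : ℂ)) • f (γ₁ - (n - i)) (γ₂ - i) k₁ k₂

/-- Multiplication by
`ι_{z₂,z₁} z₁₂^n = ∑_{i ≥ 0} (-1)^{n+i} (n choose i) z₁^i z₂^{n-i}`. It is applied to
`b(z₂) a(z₁) v`, where each coefficient of the result is a finite sum. -/
noncomputable def iota21 (n : ℤ) (f : LogSeries₂ W) : LogSeries₂ W :=
  fun γ₁ γ₂ k₁ k₂ => ∑ᶠ i : ℕ,
    ((-1 : ℂ) ^ (n + i) * (Ring.choose n i : ℂ)) • f (γ₁ - i) (γ₂ - (n - i)) k₁ k₂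

/-! ### Locality and `n`-th products -/

/-- `z₁₂^N a(z₁) b(z₂) = z₁₂^N b(z₂) a(z₁)`. -/
def IsLocalOfOrder (N : ℕ) (a b : W →ₗ[ℂ] LogSeries W) : Prop :=
  ∀ v : W, (mulZ12 ^ N) (comp12 a b v) = (mulZ12 ^ N) (comp21 a b v)

/-- The pair `(a, b)` is local. -/
def IsLocal (a b : W →ₗ[ℂ] LogSeries W) : Prop :=
  ∃ N : ℕ, IsLocalOfOrder N a b

/-- Every pair of members of the collection is local. -/
def IsLocalCollection (S : Set (W →ₗ[ℂ] LogSeries W)) : Prop :=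
  ∀ a ∈ S, ∀ b ∈ S, IsLocal a b

/-- The `n`-th product of two fields computed from the locality exponent `N`:
`D_{z₁}^{(N-1-n)} (z₁₂^N a(z₁) b(z₂) v)` at `z₁ = z₂ = z` if `n ≤ N - 1`, and `0` if
`n ≥ N`. -/
noncomputable def nthProductOfOrder (N : ℕ) (a b : W →ₗ[ℂ] LogSeries W) (n : ℤ) (v : W) :
    LogSeries W :=
  if n ≤ (N : ℤ) - 1 then
    diag (divPow Dz1 ((N : ℤ) - 1 - n).toNat ((mulZ12 ^ N) (comp12 a b v)))
  else 0

/-- The `n`-th product `(a_(n) b)(z) v` of two local logarithmic fields; it is computed from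
the least `N` for which locality holds (any other such `N` gives the same value). -/
noncomputable def nthProduct (a b : W →ₗ[ℂ] LogSeries W) (n : ℤ) (v : W) : LogSeries W :=
  nthProductOfOrder (sInf {N : ℕ | IsLocalOfOrder N a b}) a b n v

end Series

/-! ### Twisted modules and the Borcherds identity -/

section Modules

variable {V W : Type*} [AddCommGroup V] [Module ℂ V] [VertexAlgebra V]
  [AddCommGroup W] [Module ℂ W]

/-- `Y(φa, z) = e^{2πi D_ζ} Y(a, z)` for all `a ∈ V`. -/
def IsEquivariant (φ : V ≃ₗ[ℂ] V) (Y : V →ₗ[ℂ] LF W) : Prop :=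
  ∀ (a : V) (v : W), (Y (φ a)).1 v = monodromy ((Y a).1 v)

/-- `Y(a_(n) b, z) = Y(a, z)_(n) Y(b, z)` for all `a, b ∈ V`, `n ∈ ℤ`. -/
def NthProductIdentity (Y : V →ₗ[ℂ] LF W) : Prop :=
  ∀ (a b : V) (n : ℤ) (v : W),
    (Y (VertexAlgebra.prod n a b)).1 v = nthProduct (Y a).1 (Y b).1 n v

/-- `Y(V)` is a local collection. -/
def HasLocalImage (Y : V →ₗ[ℂ] LF W) : Prop :=
  IsLocalCollection (Set.range fun a : V => (Y a).1)

/-- `(W, Y)` is a `φ`-twisted `V`-module. -/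
structure IsTwistedModule (φ : V ≃ₗ[ℂ] V) (Y : V →ₗ[ℂ] LF W) : Prop where
  vacuum : (Y VertexAlgebra.vac).1 = idField W
  isLocal : HasLocalImage Y
  equivariant : IsEquivariant φ Y
  nthProduct_identity : NthProductIdentity Y

/-- The shifted delta function applied to `a`,
`δ_{α+𝒩}(z₁,z₂) a = ∑_{m ∈ α + ℤ} z₁^{-m-1} z₂^m e^{(ζ₂-ζ₁)𝒩} a`, a series with coefficients
in `V`. The coefficient of `ζ₁^k₁ ζ₂^k₂` in `e^{(ζ₂-ζ₁)𝒩} a` is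
`(-1)^k₁ 𝒩^{k₁+k₂} a / (k₁! k₂!)`. -/
noncomputable def shiftedDelta (α : ℂ) (𝒩 : Module.End ℂ V) (a : V) : LogSeries₂ V := by
  classical
  exact fun γ₁ γ₂ k₁ k₂ =>
    if (∃ j : ℤ, γ₂ = α + j) ∧ γ₁ = -γ₂ - 1 then
      ((-1 : ℂ) ^ k₁ / ((k₁.factorial : ℂ) * (k₂.factorial : ℂ))) • (𝒩 ^ (k₁ + k₂)) a
    else 0

/-- For a series `s(z₁,z₂)` with coefficients in `V`, the series `Y(s(z₁,z₂)_(n) b, z₂) v`,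
where the variables in `s` are treated as scalars. The sum over `γ` is finite for the
derivatives of the shifted delta function. -/
noncomputable def fieldOfSeries (Y : V →ₗ[ℂ] LF W) (n : ℤ) (s : LogSeries₂ V) (b : V)
    (v : W) : LogSeries₂ W :=
  fun γ₁ γ₂ k₁ k₂ => ∑ᶠ γ : ℂ, ∑ p ∈ Finset.HasAntidiagonal.antidiagonal k₂,
    (Y (VertexAlgebra.prod n (s γ₁ γ k₁ p.1) b)).1 v (γ₂ - γ) p.2

/-- The Borcherds identity in delta-function form: for `a ∈ V_α`, `b ∈ V`, `v ∈ W`, `n ∈ ℤ`,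
`ι_{z₁,z₂} z₁₂^n Y(a,z₁)Y(b,z₂)v - ι_{z₂,z₁} z₁₂^n Y(b,z₂)Y(a,z₁)v
  = ∑_{j ≥ 0} Y((D_{z₂}^{(j)} δ_{α+𝒩}(z₁,z₂) a)_(n+j) b, z₂) v`. -/
def BorcherdsIdentity (σ 𝒩 : Module.End ℂ V) (Y : V →ₗ[ℂ] LF W) : Prop :=
  ∀ (α : ℂ) (a : V), a ∈ sigmaSpace σ α → ∀ (b : V) (v : W) (n : ℤ)
    (γ₁ γ₂ : ℂ) (k₁ k₂ : ℕ),
    iota12 n (comp12 (Y a).1 (Y b).1 v) γ₁ γ₂ k₁ k₂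
        - iota21 n (comp21 (Y a).1 (Y b).1 v) γ₁ γ₂ k₁ k₂
      = ∑ᶠ j : ℕ,
          fieldOfSeries Y (n + j) (divPow Dz2 j (shiftedDelta α 𝒩 a)) b v γ₁ γ₂ k₁ k₂

end Modules

end TwistedModules

/-!
An automorphism `φ` that is locally finite has a Jordan decomposition `φ = σ e^{-2πi𝒩}`: the
semisimple part `σ` acts by `μ` on the generalized eigenspace of eigenvalue `μ`, and
`-2πi𝒩 = log (σ⁻¹ φ)` (`exists_isJordanDecomposition`). Hence `V` is spanned by the spaces `V_α`,
and since locality and `n`-th products are additive in the field `a`, it suffices to treat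
`a ∈ V_α`.

*Locality.* As `𝒩` is locally nilpotent, there is an `N` with `(𝒩^l a)_(n) b = 0` for all `l` and all
`n ≥ N`. The right-hand side of the Borcherds identity for `n = N` is then zero, and both expansions
of `z₁₂^N` are multiplication by `z₁₂^N`.

*`n`-th products.* Let `F = z₁₂^N Y(a,z₁) Y(b,z₂) v`. By locality its exponents are bounded below
in both variables, so it may be multiplied by `(ι_{z₁,z₂} - ι_{z₂,z₁}) z₁₂^{-1-i}`, and the Borcherds
identity for `n = N - 1 - i` evaluates this product as
`∑_{j ≤ i} Y((D_{z₂}^{(j)} δ_{α+𝒩} a)_(n+j) b, z₂) v`. The derivation `D_{z₁}` lowers the exponent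
`-1-i` on the left, and acts as `-D_{z₂}` on `δ_{α+𝒩}` on the right. An induction on `k` based on
these two facts (`eq_sum_choose_smul`) shows that `δ(z₁,z₂) D_{z₁}^{(k)} F` equals
`Y((δ_{α+𝒩} a)_(N-1-k) b, z₂) v`, where `δ = (ι_{z₁,z₂} - ι_{z₂,z₁}) z₁₂^{-1}`. Multiplication by `δ`
sums the coefficients of `D_{z₁}^{(k)} F` along cosets of `ℤ` in the exponent of `z₁`; adding up over
all cosets and setting `ζ₁ = ζ₂`, which turns `e^{(ζ₂-ζ₁)𝒩}` into `1`, gives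
`D_{z₁}^{(k)} F |_{z₁ = z₂} = Y(a_(N-1-k) b, z) v` (`diag_eq_of_iotaDiff_eq`).
-/

namespace TwistedModules

/-! ### Jordan decomposition of locally finite automorphisms -/

section Jordan

open PowerSeries

variable {V : Type*} [AddCommGroup V] [Module ℂ V]

/-- The value `f(ν) a = ∑ fₗ νˡ a` of a power series at an operator; the sum is finite when `ν` is
locally nilpotent. -/
noncomputable def seriesApply (ν : Module.End ℂ V) (f : PowerSeries ℂ) (a : V) : V :=
  ∑ᶠ l : ℕ, coeff l f • (ν ^ l) a

lemma pow_apply_eq_zero_of_le {ν : Module.End ℂ V} {a : V} {m l : ℕ} (h : (ν ^ m) a = 0)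
    (hml : m ≤ l) : (ν ^ l) a = 0 := by
  obtain ⟨d, rfl⟩ := Nat.exists_eq_add_of_le' hml
  rw [pow_add, Module.End.mul_apply, h, map_zero]

lemma seriesApply_eq_sum {ν : Module.End ℂ V} {a : V} {m : ℕ} (h : (ν ^ m) a = 0)
    (f : PowerSeries ℂ) :
    seriesApply ν f a = ∑ l ∈ Finset.range m, coeff l f • (ν ^ l) a := by
  refine finsum_eq_sum_of_support_subset _ fun l hl => ?_
  by_contra hlm
  refine hl ?_
  have : m ≤ l := by simpa using hlm
  simp only [pow_apply_eq_zero_of_le h this, smul_zero]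

/-- On a vector killed by `ν ^ m`, only the residue modulo `X ^ m` of a power series matters. -/
lemma seriesApply_eq_aeval {ν : Module.End ℂ V} {a : V} {m : ℕ} (h : (ν ^ m) a = 0)
    {f : PowerSeries ℂ} {p : Polynomial ℂ} (hp : ∀ l < m, p.coeff l = coeff l f) :
    seriesApply ν f a = Polynomial.aeval ν p a := by
  have hn : p.natDegree < max m (p.natDegree + 1) := by omega
  rw [seriesApply_eq_sum (pow_apply_eq_zero_of_le h (le_max_left m (p.natDegree + 1))),
    Polynomial.aeval_eq_sum_range' hn, LinearMap.sum_apply]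
  refine Finset.sum_congr rfl fun l _ => ?_
  rw [LinearMap.smul_apply]
  by_cases hl : l < m
  · rw [hp l hl]
  · rw [pow_apply_eq_zero_of_le h (not_lt.1 hl), smul_zero, smul_zero]

lemma coeff_trunc_of_lt (f : PowerSeries ℂ) {m l : ℕ} (hl : l < m) :
    (trunc m f).coeff l = coeff l f := by
  rw [coeff_trunc, if_pos hl]

/-- A power series in a locally nilpotent operator, as an operator. -/
noncomputable def seriesEnd (ν : Module.End ℂ V) (hν : IsLocallyNilpotent ν)
    (f : PowerSeries ℂ) : Module.End ℂ V where
  toFun := seriesApply ν f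
  map_add' a b := by
    obtain ⟨m, hm⟩ := hν a
    obtain ⟨n, hn⟩ := hν b
    have ha := pow_apply_eq_zero_of_le hm (le_max_left m n)
    have hb := pow_apply_eq_zero_of_le hn (le_max_right m n)
    have hab : (ν ^ max m n) (a + b) = 0 := by rw [map_add, ha, hb, add_zero]
    rw [seriesApply_eq_sum ha, seriesApply_eq_sum hb, seriesApply_eq_sum hab,
      ← Finset.sum_add_distrib]
    exact Finset.sum_congr rfl fun l _ => by rw [map_add, smul_add]
  map_smul' c a := by
    obtain ⟨m, hm⟩ := hν a
    have hc : (ν ^ m) (c • a) = 0 := by rw [map_smul, hm, smul_zero]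
    rw [seriesApply_eq_sum hm, seriesApply_eq_sum hc, Finset.smul_sum]
    exact Finset.sum_congr rfl fun l _ => by rw [map_smul, smul_comm, RingHom.id_apply]

lemma seriesEnd_mul (ν : Module.End ℂ V) (hν : IsLocallyNilpotent ν) (f g : PowerSeries ℂ) :
    seriesEnd ν hν (f * g) = seriesEnd ν hν f * seriesEnd ν hν g := by
  ext a
  obtain ⟨m, hm⟩ := hν a
  change seriesApply ν (f * g) a = seriesApply ν f (seriesApply ν g a)
  rw [seriesApply_eq_aeval hm fun l hl => coeff_trunc_of_lt g hl]
  have hq : (ν ^ m) (Polynomial.aeval ν (trunc m g) a) = 0 := by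
    rw [← Module.End.mul_apply,
      (Polynomial.aeval_X_pow (R := ℂ) (n := m) ν).symm, ← map_mul, mul_comm, map_mul,
      Module.End.mul_apply, Polynomial.aeval_X_pow, hm, map_zero]
  rw [seriesApply_eq_aeval hq fun l hl => coeff_trunc_of_lt f hl, ← Module.End.mul_apply,
    ← map_mul]
  refine seriesApply_eq_aeval hm fun l hl => ?_
  rw [Polynomial.coeff_mul, coeff_mul]
  refine Finset.sum_congr rfl fun p hp => ?_
  have := Finset.HasAntidiagonal.mem_antidiagonal.1 hp
  rw [coeff_trunc_of_lt f (by omega), coeff_trunc_of_lt g (by omega)]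

lemma seriesEnd_pow (ν : Module.End ℂ V) (hν : IsLocallyNilpotent ν) (f : PowerSeries ℂ)
    (l : ℕ) : seriesEnd ν hν f ^ l = seriesEnd ν hν (f ^ l) := by
  induction l with
  | zero =>
    ext a
    change a = seriesApply ν (f ^ 0) a
    obtain ⟨m, hm⟩ := hν a
    rw [seriesApply_eq_aeval hm (p := 1), map_one, Module.End.one_apply]
    intro l _
    rw [pow_zero, Polynomial.coeff_one, coeff_one]
  | succ l ih => rw [pow_succ, ih, pow_succ, seriesEnd_mul]

lemma commute_seriesEnd {ν σ : Module.End ℂ V} (hν : IsLocallyNilpotent ν)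
    (h : Commute σ ν) (f : PowerSeries ℂ) : Commute σ (seriesEnd ν hν f) := by
  ext a
  obtain ⟨m, hm⟩ := hν a
  change σ (seriesApply ν f a) = seriesApply ν f (σ a)
  have hc : ∀ l, (ν ^ l) (σ a) = σ ((ν ^ l) a) := fun l =>
    (LinearMap.congr_fun (h.pow_right l).eq a).symm
  rw [seriesApply_eq_sum hm, seriesApply_eq_sum (m := m) (by rw [hc, hm, map_zero]), map_sum]
  exact Finset.sum_congr rfl fun l _ => by rw [map_smul, hc]

/-- `exp (log (1 + X)) = 1 + X`, in truncated form. Both sides solve `(1 + X) G' = G`, up to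
the error `log (1 + X) ^ m / m!` on the left, and have the same constant term. -/
lemma coeff_sum_log_pow (m l : ℕ) (hl : l < m) :
    coeff l (∑ i ∈ Finset.range m, (i.factorial : ℂ)⁻¹ • PowerSeries.log ℂ ^ i)
      = coeff l (1 + X : PowerSeries ℂ) := by
  set L := PowerSeries.log ℂ with hL
  have hXL : X ∣ L := X_dvd_iff.2 constantCoeff_log
  have hLd : (1 + X) * d⁄dX ℂ L = 1 := by
    ext n
    rw [hL, deriv_log, add_mul, one_mul, map_add]
    cases n with
    | zero => simp
    | succ n =>
      rw [coeff_succ_X_mul, coeff_mk, coeff_mk, coeff_one, if_neg (by omega), ← map_add,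
        pow_succ]
      simp
  obtain ⟨m, rfl⟩ : ∃ n, m = n + 1 := ⟨m - 1, by omega⟩
  set E := ∑ i ∈ Finset.range (m + 1), (i.factorial : ℂ)⁻¹ • L ^ i with hE
  have hder : (1 + X) * d⁄dX ℂ E = ∑ i ∈ Finset.range m, (i.factorial : ℂ)⁻¹ • L ^ i := by
    rw [hE, map_sum, Finset.mul_sum, Finset.sum_range_succ']
    simp only [Nat.factorial_zero, pow_zero, Derivation.map_smul]
    rw [show d⁄dX ℂ (1 : PowerSeries ℂ) = 0 from Derivation.map_one_eq_zero _, smul_zero,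
      mul_zero, add_zero]
    refine Finset.sum_congr rfl fun i _ => ?_
    rw [Derivation.leibniz_pow, Nat.add_sub_cancel, mul_smul_comm, mul_smul_comm, smul_eq_mul,
      mul_left_comm, hLd, mul_one, ← Nat.cast_smul_eq_nsmul ℂ, smul_smul, Nat.factorial_succ]
    congr 1
    have : ((i : ℂ) + 1) ≠ 0 := Nat.cast_add_one_ne_zero i
    have : (i.factorial : ℂ) ≠ 0 := Nat.cast_ne_zero.2 i.factorial_ne_zero
    push_cast
    field_simp
  have hrec : ∀ k < m, ((k : ℂ) + 1) * coeff (k + 1) E = (1 - k) * coeff k E := by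
    intro k hk
    have h1 := congrArg (coeff k) hder
    have h2 : coeff k E = coeff k (∑ i ∈ Finset.range m, (i.factorial : ℂ)⁻¹ • L ^ i) := by
      rw [hE, Finset.sum_range_succ, map_add, map_smul,
        X_pow_dvd_iff.1 (pow_dvd_pow_of_dvd hXL m) k hk, smul_zero, add_zero]
    rw [← h2, add_mul, one_mul, map_add, coeff_derivative] at h1
    cases k with
    | zero => simpa using h1
    | succ k =>
      rw [coeff_succ_X_mul, coeff_derivative] at h1
      push_cast at h1 ⊢
      linear_combination h1
  have h0 : coeff 0 E = 1 := by
    rw [hE, Finset.sum_range_succ']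
    simp only [map_add, map_sum, map_smul, coeff_zero_eq_constantCoeff]
    rw [Finset.sum_eq_zero]
    · simp
    · intro i _
      rw [map_pow, hL, constantCoeff_log]
      simp
  have hrest : ∀ k, k + 2 ≤ m → coeff (k + 2) E = 0 := by
    intro k
    induction k with
    | zero =>
      intro hk
      have := hrec 1 (by omega)
      norm_num at this
      exact this
    | succ k ih =>
      intro hk
      have := hrec (k + 2) (by omega)
      rw [ih (by omega), mul_zero] at this
      exact (mul_eq_zero.1 this).resolve_left (Nat.cast_add_one_ne_zero _)
  rcases l with _ | _ | l
  · simp [h0]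
  · have := hrec 0 (by omega)
    rw [h0] at this
    simpa [coeff_X, coeff_one] using this
  · rw [hrest l (by omega)]
    simp [coeff_X, coeff_one]

/-- The exponential is onto: `1 + ν = e^{c𝒩}` for `𝒩 = c⁻¹ log (1 + ν)`. -/
lemma exists_expApply_eq {ν : Module.End ℂ V} (hν : IsLocallyNilpotent ν) {c : ℂ} (hc : c ≠ 0) :
    ∃ 𝒩 : Module.End ℂ V, IsLocallyNilpotent 𝒩 ∧
      (∀ σ : Module.End ℂ V, Commute σ ν → Commute σ 𝒩) ∧
      ∀ a, expApply c 𝒩 a = a + ν a := by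
  set L := PowerSeries.log ℂ with hL
  have hXL : X ∣ L := X_dvd_iff.2 constantCoeff_log
  have hzero : ∀ {a : V} {m l : ℕ}, (ν ^ m) a = 0 → m ≤ l → seriesApply ν (L ^ l) a = 0 := by
    intro a m l hm hml
    rw [seriesApply_eq_sum hm]
    refine Finset.sum_eq_zero fun i hi => ?_
    rw [X_pow_dvd_iff.1 (pow_dvd_pow_of_dvd hXL l) i
      (lt_of_lt_of_le (Finset.mem_range.1 hi) hml), zero_smul]
  have hpow : ∀ (l : ℕ) (a : V), ((c⁻¹ • seriesEnd ν hν L) ^ l) a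
      = (c⁻¹) ^ l • seriesApply ν (L ^ l) a := by
    intro l a
    rw [smul_pow, seriesEnd_pow]
    rfl
  refine ⟨c⁻¹ • seriesEnd ν hν L, fun a => ?_, fun σ h => ?_, fun a => ?_⟩
  · obtain ⟨m, hm⟩ := hν a
    exact ⟨m, by rw [hpow, hzero hm le_rfl, smul_zero]⟩
  · exact (commute_seriesEnd hν h L).smul_right _
  · obtain ⟨m, hm⟩ := hν a
    have hm' := pow_apply_eq_zero_of_le hm (Nat.le_add_right m 2)
    have hterm : ∀ l : ℕ, (c ^ l / (l.factorial : ℂ)) • ((c⁻¹ • seriesEnd ν hν L) ^ l) a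
        = (l.factorial : ℂ)⁻¹ • seriesApply ν (L ^ l) a := by
      intro l
      rw [hpow, smul_smul]
      congr 1
      have : c ^ l ≠ 0 := pow_ne_zero l hc
      rw [inv_pow]
      field_simp
    have h1 : expApply c (c⁻¹ • seriesEnd ν hν L) a
        = ∑ l ∈ Finset.range (m + 2), (l.factorial : ℂ)⁻¹ • seriesApply ν (L ^ l) a := by
      rw [expApply, finsum_congr hterm]
      refine finsum_eq_sum_of_support_subset _ fun l hl => ?_
      by_contra hlm
      refine hl ?_
      have : m + 2 ≤ l := by simpa using hlm
      simp only [hzero hm' this, smul_zero]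
    have h2 : ∑ l ∈ Finset.range (m + 2), (l.factorial : ℂ)⁻¹ • seriesApply ν (L ^ l) a
        = seriesApply ν (1 + X) a := by
      rw [seriesApply_eq_sum hm']
      simp only [seriesApply_eq_sum hm', Finset.smul_sum, smul_smul]
      rw [Finset.sum_comm]
      refine Finset.sum_congr rfl fun i hi => ?_
      rw [← coeff_sum_log_pow (m + 2) i (Finset.mem_range.1 hi), map_sum, ← Finset.sum_smul]
      simp only [map_smul, smul_eq_mul, hL]
    rw [h1, h2, seriesApply_eq_aeval hm' (p := 1 + Polynomial.X)]
    · simp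
    · intro l _
      simp [Polynomial.coeff_X, coeff_X, Polynomial.coeff_one, coeff_one, eq_comm]

lemma iSup_maxGenEigenspace_eq_top {φ : Module.End ℂ V} (hfin : IsLocallyFinite φ) :
    ⨆ μ : ℂ, φ.maxGenEigenspace μ = ⊤ := by
  rw [eq_top_iff]
  intro a _
  obtain ⟨U, hU, haU, hinv⟩ := hfin a
  have htop := Module.End.iSup_maxGenEigenspace_eq_top (K := ℂ) (V := U) (φ.restrict hinv)
  have hmem : (⟨a, haU⟩ : U) ∈ ⨆ μ : ℂ, Module.End.maxGenEigenspace (φ.restrict hinv) μ := by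
    rw [htop]; trivial
  have hmap : Submodule.map U.subtype (⨆ μ : ℂ, Module.End.maxGenEigenspace (φ.restrict hinv) μ)
      ≤ ⨆ μ : ℂ, φ.maxGenEigenspace μ := by
    rw [Submodule.map_iSup]
    refine iSup_mono fun μ => ?_
    rw [Module.End.maxGenEigenspace, Module.End.genEigenspace_restrict,
      Submodule.map_le_iff_le_comap]
  exact hmap (Submodule.mem_map_of_mem (f := U.subtype) hmem)

/-- Multiplication by prescribed scalars on the summands of a direct sum decomposition. -/
lemma exists_end_smul_of_independent {ι : Type*} {G : ι → Submodule ℂ V}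
    (hind : iSupIndep G) (htop : ⨆ i, G i = ⊤) (c : ι → ℂ) :
    ∃ f : Module.End ℂ V, ∀ i, ∀ x ∈ G i, f x = c i • x := by
  classical
  have hint := DirectSum.isInternal_submodule_of_iSupIndep_of_iSup_eq_top hind htop
  let e := LinearEquiv.ofBijective (DirectSum.coeLinearMap G) hint
  refine ⟨e.toLinearMap ∘ₗ DirectSum.lmap (fun i => c i • LinearMap.id) ∘ₗ e.symm.toLinearMap,
    fun i x hx => ?_⟩
  have he : e (DirectSum.lof ℂ ι (fun i => G i) i ⟨x, hx⟩) = x :=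
    DirectSum.coeLinearMap_lof G i ⟨x, hx⟩
  have hes : e.symm x = DirectSum.lof ℂ ι (fun i => G i) i ⟨x, hx⟩ := by
    rw [LinearEquiv.symm_apply_eq, he]
  simp only [LinearMap.comp_apply, LinearEquiv.coe_coe, hes, DirectSum.lmap_lof]
  rw [LinearMap.smul_apply, LinearMap.id_apply, map_smul, map_smul, he]

lemma end_ext_of_iSup_eq_top {ι : Type*} {G : ι → Submodule ℂ V} (htop : ⨆ i, G i = ⊤)
    {f g : Module.End ℂ V} (h : ∀ i, ∀ x ∈ G i, f x = g x) : f = g := by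
  have : ⨆ i, G i ≤ LinearMap.eqLocus f g := iSup_le fun i x hx => h i x hx
  ext x
  exact this (htop ▸ Submodule.mem_top)

/-- The semisimple part acts by `μ` on the generalized eigenspace of eigenvalue `μ`, and the
unipotent part is exponentiated logarithmically. -/
lemma exists_isJordanDecomposition (φ : V ≃ₗ[ℂ] V) (hfin : IsLocallyFinite φ.toLinearMap) :
    ∃ σ 𝒩 : Module.End ℂ V, IsJordanDecomposition φ.toLinearMap σ 𝒩 := by
  set f : Module.End ℂ V := φ.toLinearMap with hf
  set G : ℂ → Submodule ℂ V := fun μ => f.maxGenEigenspace μ with hG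
  have htop : ⨆ μ, G μ = ⊤ := iSup_maxGenEigenspace_eq_top hfin
  have hind : iSupIndep G := f.independent_maxGenEigenspace
  have hzero : ∀ x ∈ G 0, x = 0 := by
    intro x hx
    obtain ⟨k, hk⟩ := (Module.End.mem_maxGenEigenspace f 0 x).1 hx
    rw [zero_smul, sub_zero] at hk
    have hinj : Function.Injective (f ^ k) := by
      rw [Module.End.coe_pow]
      exact φ.injective.iterate k
    exact hinj (by rw [hk, map_zero])
  obtain ⟨σ, hσ⟩ := exists_end_smul_of_independent hind htop fun μ => μ
  obtain ⟨τ, hτ⟩ := exists_end_smul_of_independent hind htop fun μ => μ⁻¹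
  have hfG : ∀ μ, ∀ x ∈ G μ, f x ∈ G μ := fun μ x hx =>
    Module.End.mapsTo_maxGenEigenspace_of_comm (Commute.refl f) μ hx
  have hστ : σ * τ = 1 := end_ext_of_iSup_eq_top htop fun μ x hx => by
    rw [Module.End.mul_apply, hτ μ x hx, map_smul, hσ μ x hx, smul_smul, Module.End.one_apply]
    by_cases h : μ = 0
    · subst h
      rw [hzero x hx, smul_zero]
    · rw [inv_mul_cancel₀ h, one_smul]
  have hτσ : τ * σ = 1 := end_ext_of_iSup_eq_top htop fun μ x hx => by
    rw [Module.End.mul_apply, hσ μ x hx, map_smul, hτ μ x hx, smul_smul, Module.End.one_apply]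
    by_cases h : μ = 0
    · subst h
      rw [hzero x hx, smul_zero]
    · rw [mul_inv_cancel₀ h, one_smul]
  have hσf : Commute σ f := end_ext_of_iSup_eq_top htop fun μ x hx => by
    rw [Module.End.mul_apply, Module.End.mul_apply, hσ μ x hx, hσ μ _ (hfG μ x hx), map_smul]
  have hστc : Commute σ τ := hστ.trans hτσ.symm
  set ν : Module.End ℂ V := τ * f - 1 with hνdef
  have hνpow : ∀ μ, μ ≠ 0 → ∀ (k : ℕ), ∀ x ∈ G μ,
      (ν ^ k) x = (μ⁻¹) ^ k • ((f - μ • 1) ^ k) x := by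
    intro μ hμ k
    induction k with
    | zero => intro x _; simp
    | succ k ih =>
      intro x hx
      have h1 : ν x = μ⁻¹ • (f - μ • 1) x := by
        rw [hνdef, LinearMap.sub_apply, Module.End.mul_apply, hτ μ _ (hfG μ x hx),
          LinearMap.sub_apply, smul_sub, LinearMap.smul_apply, smul_smul, inv_mul_cancel₀ hμ,
          one_smul]
      have h2 : (f - μ • 1) x ∈ G μ := by
        rw [LinearMap.sub_apply, LinearMap.smul_apply, Module.End.one_apply]
        exact Submodule.sub_mem _ (hfG μ x hx) (Submodule.smul_mem _ _ hx)
      rw [pow_succ, Module.End.mul_apply, h1, map_smul, ih _ h2, smul_smul, pow_succ _ k,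
        pow_succ _ k, Module.End.mul_apply, mul_comm]
  have hν : IsLocallyNilpotent ν := by
    intro a
    have ha : a ∈ ⨆ μ, G μ := htop ▸ Submodule.mem_top
    induction ha using Submodule.iSup_induction' with
    | mem μ x hx =>
      by_cases hμ : μ = 0
      · subst hμ
        exact ⟨0, by rw [hzero x hx, map_zero]⟩
      · obtain ⟨k, hk⟩ := (Module.End.mem_maxGenEigenspace f μ x).1 hx
        exact ⟨k, by rw [hνpow μ hμ k x hx, hk, smul_zero]⟩
    | zero => exact ⟨0, by rw [map_zero]⟩
    | add x y _ _ hx hy =>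
      obtain ⟨m, hm⟩ := hx
      obtain ⟨n, hn⟩ := hy
      exact ⟨max m n, by rw [map_add, pow_apply_eq_zero_of_le hm (le_max_left m n),
        pow_apply_eq_zero_of_le hn (le_max_right m n), add_zero]⟩
  have hσν : Commute σ ν := (hστc.mul_right hσf).sub_right (Commute.one_right σ)
  have hc : (-(2 * Real.pi * Complex.I) : ℂ) ≠ 0 := neg_ne_zero.2 Complex.two_pi_I_ne_zero
  obtain ⟨𝒩, h𝒩, hcomm, hexp⟩ := exists_expApply_eq hν hc
  refine ⟨σ, 𝒩, ?_, h𝒩, hcomm σ hσν, fun a => ?_⟩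
  · rw [eq_top_iff, ← htop]
    exact iSup_mono fun μ x hx => Module.End.mem_eigenspace_iff.2 (hσ μ x hx)
  · rw [hexp, hνdef, LinearMap.sub_apply, Module.End.one_apply, add_sub_cancel,
      ← Module.End.mul_apply, ← mul_assoc, hστ, one_mul]

/-- The semisimple part of an automorphism is injective, so all its eigenvalues have the form
`e^{-2πiα}`. -/
lemma iSup_sigmaSpace_eq_top {φ : V ≃ₗ[ℂ] V} {σ 𝒩 : Module.End ℂ V}
    (h : IsJordanDecomposition φ.toLinearMap σ 𝒩) : ⨆ α : ℂ, sigmaSpace σ α = ⊤ := by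
  rw [eq_top_iff, ← h.semisimple]
  refine iSup_le fun μ x hx => ?_
  by_cases hμ : μ = 0
  · have hσx : σ x = 0 := by
      rw [Module.End.mem_eigenspace_iff.1 hx, hμ, zero_smul]
    obtain ⟨m, hm⟩ := h.locallyNilpotent x
    have hx0 : φ x = 0 := by
      have := h.decomposition x
      rw [expApply, finsum_eq_sum_of_support_subset (s := Finset.range m), map_sum] at this
      · refine this.trans (Finset.sum_eq_zero fun l _ => ?_)
        rw [map_smul, ← Module.End.mul_apply, (h.commute.pow_right l).eq, Module.End.mul_apply,
          hσx, map_zero, smul_zero]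
      · intro l hl
        by_contra hlm
        refine hl ?_
        have : m ≤ l := by simpa using hlm
        simp only [pow_apply_eq_zero_of_le hm this, smul_zero]
    rw [(LinearEquiv.map_eq_zero_iff φ).1 hx0]
    exact Submodule.zero_mem _
  · refine Submodule.mem_iSup_of_mem (-(Complex.log μ / (2 * Real.pi * Complex.I))) ?_
    have : -(2 * Real.pi * Complex.I * -(Complex.log μ / (2 * Real.pi * Complex.I)))
        = Complex.log μ := by
      rw [mul_neg, neg_neg, mul_div_cancel₀ _ Complex.two_pi_I_ne_zero]
    rw [sigmaSpace, this, Complex.exp_log hμ]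
    exact hx

end Jordan

/-! ### Generalized binomial sums -/

section Binomial

lemma succ_mul_choose_succ (r : ℂ) (i : ℕ) :
    ((i : ℂ) + 1) * Ring.choose r (i + 1) = r * Ring.choose (r - 1) i := by
  have h1 := Ring.descPochhammer_eq_factorial_smul_choose r (i + 1)
  have h2 := Ring.descPochhammer_eq_factorial_smul_choose (r - 1) i
  have h3 : ((Polynomial.X - 1 : Polynomial ℤ)).smeval r = r - 1 := by
    simp [Polynomial.smeval_sub, Polynomial.smeval_X, Polynomial.smeval_one]
  rw [descPochhammer_succ_left, Polynomial.smeval_X_mul, Polynomial.smeval_comp, h3, h2,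
    nsmul_eq_mul, nsmul_eq_mul, Nat.factorial_succ] at h1
  have h4 : (i.factorial : ℂ) ≠ 0 := Nat.cast_ne_zero.2 i.factorial_ne_zero
  apply mul_left_cancel₀ h4
  push_cast at h1
  linear_combination -h1

lemma sub_mul_choose (r : ℂ) (i : ℕ) :
    (r - i) * Ring.choose r i = r * Ring.choose (r - 1) i := by
  cases i with
  | zero => simp
  | succ j =>
    have h1 := succ_mul_choose_succ r j
    have h2 := Ring.choose_succ_succ (r - 1) j
    rw [sub_add_cancel] at h2
    push_cast
    linear_combination -h1 + r * h2

variable {W : Type*} [AddCommGroup W]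

lemma finsum_eq_sum_range {u : ℕ → W} {M : ℕ} (h : ∀ i, M ≤ i → u i = 0) :
    ∑ᶠ i, u i = ∑ i ∈ Finset.range M, u i := by
  refine finsum_eq_sum_of_support_subset _ fun i hi => ?_
  by_contra hM
  exact hi (h i (by simpa using hM))

variable [Module ℂ W]

/-- The alternating binomial sum `∑ (-1)^i (n choose i) uᵢ` of a sequence with finitely many
nonzero terms. -/
noncomputable def altSum (n : ℤ) (u : ℕ → W) : W :=
  ∑ᶠ i : ℕ, ((-1 : ℂ) ^ i * (Ring.choose n i : ℂ)) • u i

lemma altSum_eq_sum (n : ℤ) {u : ℕ → W} {M : ℕ} (h : ∀ i, M ≤ i → u i = 0) :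
    altSum n u = ∑ i ∈ Finset.range M, ((-1 : ℂ) ^ i * (Ring.choose n i : ℂ)) • u i :=
  finsum_eq_sum_range fun i hi => by rw [h i hi, smul_zero]

lemma altSum_add (n : ℤ) {u w : ℕ → W} {M : ℕ} (hu : ∀ i, M ≤ i → u i = 0)
    (hw : ∀ i, M ≤ i → w i = 0) :
    altSum n (fun i => u i + w i) = altSum n u + altSum n w := by
  rw [altSum_eq_sum n hu, altSum_eq_sum n hw,
    altSum_eq_sum n fun i hi => by rw [hu i hi, hw i hi, add_zero], ← Finset.sum_add_distrib]
  exact Finset.sum_congr rfl fun i _ => smul_add _ _ _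

lemma altSum_smul (n : ℤ) (c : ℂ) (u : ℕ → W) :
    altSum n (fun i => c • u i) = c • altSum n u := by
  rw [altSum, altSum, smul_finsum]
  exact finsum_congr fun i => smul_comm _ _ _

/-- Pascal's rule. -/
lemma altSum_sub_succ (n : ℤ) {u : ℕ → W} {M : ℕ} (h : ∀ i, M ≤ i → u i = 0) :
    altSum n (fun i => u i - u (i + 1)) = altSum (n + 1) u := by
  rw [altSum_eq_sum n (u := fun i => u i - u (i + 1)) (M := M + 1)
      fun i hi => by rw [h i (by omega), h (i + 1) (by omega), sub_zero],
    altSum_eq_sum (n + 1) (u := u) (M := M + 2) fun i hi => h i (by omega)]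
  simp only [smul_sub, Finset.sum_sub_distrib]
  rw [Finset.sum_range_succ' _ (M + 1), Finset.sum_range_succ' _ M]
  have : ∑ i ∈ Finset.range (M + 1),
        ((-1 : ℂ) ^ (i + 1) * (Ring.choose ((n + 1 : ℤ) : ℂ) (i + 1) : ℂ)) • u (i + 1)
      = ∑ i ∈ Finset.range (M + 1), ((-1 : ℂ) ^ (i + 1) * (Ring.choose n (i + 1) : ℂ)) • u (i + 1)
        - ∑ i ∈ Finset.range (M + 1), ((-1 : ℂ) ^ i * (Ring.choose n i : ℂ)) • u (i + 1) := by
    rw [← Finset.sum_sub_distrib]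
    refine Finset.sum_congr rfl fun i _ => ?_
    rw [← sub_smul, Int.cast_add, Int.cast_one, Ring.choose_succ_succ]
    congr 1
    ring
  rw [this, Finset.sum_range_succ (fun i => ((-1 : ℂ) ^ (i + 1) *
    (Ring.choose n (i + 1) : ℂ)) • u (i + 1)) M, h (M + 1) (by omega)]
  simp only [Ring.choose_zero_right, smul_zero]
  abel

lemma altSum_sub_smul (n : ℤ) (u : ℕ → W) :
    altSum n (fun i => ((n : ℂ) - i) • u i) = (n : ℂ) • altSum (n - 1) u := by
  rw [altSum, altSum, smul_finsum]
  refine finsum_congr fun i => ?_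
  rw [smul_smul, smul_smul]
  congr 1
  rw [Int.cast_sub, Int.cast_one]
  linear_combination (-1 : ℂ) ^ i * sub_mul_choose n i

lemma altSum_natCast_smul (n : ℤ) {u : ℕ → W} {M : ℕ} (h : ∀ i, M ≤ i → u i = 0) :
    altSum n (fun i => (i : ℂ) • u i) = -((n : ℂ) • altSum (n - 1) fun i => u (i + 1)) := by
  rw [altSum_eq_sum n (u := fun i => (i : ℂ) • u i) (M := M + 1)
      fun i hi => by rw [h i (by omega), smul_zero],
    altSum_eq_sum (n - 1) (u := fun i => u (i + 1)) (M := M) fun i hi => h _ (by omega),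
    Finset.sum_range_succ', Nat.cast_zero, zero_smul, smul_zero, add_zero, Finset.smul_sum,
    ← Finset.sum_neg_distrib]
  refine Finset.sum_congr rfl fun i _ => ?_
  rw [smul_smul, smul_smul, ← neg_smul]
  congr 1
  push_cast
  linear_combination (-1 : ℂ) ^ (i + 1) * succ_mul_choose_succ n i

end Binomial

/-! ### Series with exponents bounded below -/

section Bounded

/-- A set of exponents contained in finitely many translates of `ℕ`. -/
def IsBoundedBelow (B : Set ℂ) : Prop :=
  ∃ S : Finset ℂ, ∀ γ ∈ B, ∃ s ∈ S, ∃ i : ℕ, γ = s + i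

lemma IsBoundedBelow.mono {A B : Set ℂ} (h : IsBoundedBelow B) (hAB : A ⊆ B) :
    IsBoundedBelow A := by
  obtain ⟨S, hS⟩ := h
  exact ⟨S, fun γ hγ => hS γ (hAB hγ)⟩

lemma IsBoundedBelow.union {A B : Set ℂ} (hA : IsBoundedBelow A) (hB : IsBoundedBelow B) :
    IsBoundedBelow (A ∪ B) := by
  classical
  obtain ⟨S, hS⟩ := hA
  obtain ⟨T, hT⟩ := hB
  refine ⟨S ∪ T, ?_⟩
  rintro γ (hγ | hγ)
  · obtain ⟨s, hs, i, hi⟩ := hS γ hγ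
    exact ⟨s, Finset.mem_union_left _ hs, i, hi⟩
  · obtain ⟨s, hs, i, hi⟩ := hT γ hγ
    exact ⟨s, Finset.mem_union_right _ hs, i, hi⟩

lemma IsBoundedBelow.preimage_add {B : Set ℂ} (h : IsBoundedBelow B) (c : ℂ) :
    IsBoundedBelow {γ | γ + c ∈ B} := by
  classical
  obtain ⟨S, hS⟩ := h
  refine ⟨S.image fun s => s - c, fun γ hγ => ?_⟩
  obtain ⟨s, hs, i, hi⟩ := hS _ hγ
  exact ⟨s - c, Finset.mem_image_of_mem _ hs, i, by linear_combination hi⟩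

lemma finite_setOf_eq_add_natCast (c : ℂ) : {i : ℕ | ∃ j : ℕ, c = i + j}.Finite := by
  by_cases h : ∃ m : ℕ, c = m
  · obtain ⟨m, rfl⟩ := h
    refine (Set.finite_Iic m).subset ?_
    rintro i ⟨j, hj⟩
    have : m = i + j := by exact_mod_cast hj
    exact Set.mem_Iic.2 (by omega)
  · refine Set.finite_empty.subset ?_
    rintro i ⟨j, hj⟩
    exact h ⟨i + j, by rw [hj]; push_cast; rfl⟩

lemma IsBoundedBelow.finite_inter {A B : Set ℂ} (hA : IsBoundedBelow A)
    (hB : IsBoundedBelow B) (c : ℂ) : {γ | γ ∈ A ∧ c - γ ∈ B}.Finite := by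
  obtain ⟨S, hS⟩ := hA
  obtain ⟨T, hT⟩ := hB
  refine (S.finite_toSet.biUnion fun s _ => T.finite_toSet.biUnion fun t _ =>
    (finite_setOf_eq_add_natCast (c - s - t)).image fun i : ℕ => s + (i : ℂ)).subset ?_
  rintro γ ⟨h1, h2⟩
  obtain ⟨s, hs, i, hi⟩ := hS _ h1
  obtain ⟨t, ht, j, hj⟩ := hT _ h2
  simp only [Set.mem_iUnion]
  exact ⟨s, hs, t, ht, i, ⟨j, by linear_combination hi + hj⟩, hi.symm⟩

lemma IsBoundedBelow.exists_forall_sub_notMem {B : Set ℂ} (h : IsBoundedBelow B) (c : ℂ) :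
    ∃ M : ℕ, ∀ i : ℕ, M ≤ i → c - i ∉ B := by
  have hN : IsBoundedBelow (Set.range ((↑) : ℕ → ℂ)) := by
    refine ⟨{0}, ?_⟩
    rintro _ ⟨i, rfl⟩
    exact ⟨0, Finset.mem_singleton_self _, i, (zero_add _).symm⟩
  have hfin := (hN.finite_inter h c).preimage (Nat.cast_injective (R := ℂ)).injOn
  obtain ⟨M, hM⟩ := hfin.bddAbove
  refine ⟨M + 1, fun i hi hB => ?_⟩
  have : i ≤ M := hM ⟨⟨i, rfl⟩, hB⟩
  omega

variable {W : Type*} [AddCommGroup W]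

/-- The exponents of `z₂` occurring in a series in two variables; those of `z₁` form its
`Function.support`. -/
def support₂ (f : LogSeries₂ W) : Set ℂ := {γ₂ | ∃ γ₁, f γ₁ γ₂ ≠ 0}

/-- The exponents of both `z₁` and `z₂` are bounded below. -/
structure HasBoundedSupport (f : LogSeries₂ W) : Prop where
  left : IsBoundedBelow (Function.support f)
  right : IsBoundedBelow (support₂ f)

lemma eq_zero_left {f : LogSeries₂ W} {γ₁ : ℂ} (h : γ₁ ∉ Function.support f) (γ₂ : ℂ) :
    f γ₁ γ₂ = 0 := by
  rw [Function.notMem_support.1 h]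
  rfl

lemma eq_zero_right {f : LogSeries₂ W} {γ₂ : ℂ} (h : γ₂ ∉ support₂ f) (γ₁ : ℂ) :
    f γ₁ γ₂ = 0 := by
  by_contra hf
  exact h ⟨γ₁, hf⟩

variable [Module ℂ W]

lemma mulZ12_apply (f : LogSeries₂ W) (γ₁ γ₂ : ℂ) (k₁ k₂ : ℕ) :
    mulZ12 f γ₁ γ₂ k₁ k₂ = f (γ₁ - 1) γ₂ k₁ k₂ - f γ₁ (γ₂ - 1) k₁ k₂ := rfl

lemma Dz1_apply (f : LogSeries₂ W) (γ₁ γ₂ : ℂ) (k₁ k₂ : ℕ) :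
    Dz1 f γ₁ γ₂ k₁ k₂
      = (γ₁ + 1) • f (γ₁ + 1) γ₂ k₁ k₂ + ((k₁ : ℂ) + 1) • f (γ₁ + 1) γ₂ (k₁ + 1) k₂ := rfl

lemma Dz2_apply (f : LogSeries₂ W) (γ₁ γ₂ : ℂ) (k₁ k₂ : ℕ) :
    Dz2 f γ₁ γ₂ k₁ k₂
      = (γ₂ + 1) • f γ₁ (γ₂ + 1) k₁ k₂ + ((k₂ : ℂ) + 1) • f γ₁ (γ₂ + 1) k₁ (k₂ + 1) := rfl

lemma support_mulZ12_subset (f : LogSeries₂ W) : Function.support (mulZ12 f) ⊆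
    Function.support f ∪ {γ | γ + (-1) ∈ Function.support f} := by
  intro γ hγ
  by_contra hn
  simp only [Set.mem_union, Set.mem_ofPred_eq, not_or, ← sub_eq_add_neg] at hn
  refine hγ ?_
  funext γ₂ k₁ k₂
  rw [mulZ12_apply, eq_zero_left hn.1, eq_zero_left hn.2]
  exact sub_zero _

lemma support₂_mulZ12_subset (f : LogSeries₂ W) : support₂ (mulZ12 f) ⊆
    support₂ f ∪ {γ | γ + (-1) ∈ support₂ f} := by
  rintro γ ⟨γ₁, hγ⟩
  by_contra hn
  simp only [Set.mem_union, Set.mem_ofPred_eq, not_or, ← sub_eq_add_neg] at hn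
  refine hγ ?_
  funext k₁ k₂
  rw [mulZ12_apply, eq_zero_right hn.1, eq_zero_right hn.2]
  exact sub_zero _

lemma isBoundedBelow_support_mulZ12_pow {f : LogSeries₂ W}
    (h : IsBoundedBelow (Function.support f)) (N : ℕ) :
    IsBoundedBelow (Function.support ((mulZ12 ^ N) f)) := by
  induction N with
  | zero => exact h
  | succ N ih =>
    rw [pow_succ', Module.End.mul_apply]
    exact (ih.union (ih.preimage_add (-1))).mono (support_mulZ12_subset _)

lemma isBoundedBelow_support₂_mulZ12_pow {f : LogSeries₂ W}
    (h : IsBoundedBelow (support₂ f)) (N : ℕ) :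
    IsBoundedBelow (support₂ ((mulZ12 ^ N) f)) := by
  induction N with
  | zero => exact h
  | succ N ih =>
    rw [pow_succ', Module.End.mul_apply]
    exact (ih.union (ih.preimage_add (-1))).mono (support₂_mulZ12_subset _)

namespace HasBoundedSupport

lemma mulZ12_pow {f : LogSeries₂ W} (h : HasBoundedSupport f) (N : ℕ) :
    HasBoundedSupport ((mulZ12 ^ N) f) :=
  ⟨isBoundedBelow_support_mulZ12_pow h.left N, isBoundedBelow_support₂_mulZ12_pow h.right N⟩

lemma Dz1 {f : LogSeries₂ W} (h : HasBoundedSupport f) : HasBoundedSupport (Dz1 f) := by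
  constructor
  · refine (h.left.preimage_add 1).mono fun γ hγ => ?_
    by_contra hn
    refine hγ ?_
    funext γ₂ k₁ k₂
    rw [Dz1_apply, eq_zero_left hn]
    simp
  · refine h.right.mono ?_
    rintro γ ⟨γ₁, hγ⟩
    by_contra hn
    refine hγ ?_
    funext k₁ k₂
    rw [Dz1_apply, eq_zero_right hn]
    simp

lemma smul {f : LogSeries₂ W} (h : HasBoundedSupport f) (c : ℂ) : HasBoundedSupport (c • f) := by
  constructor
  · refine h.left.mono fun γ hγ hn => hγ ?_
    rw [Pi.smul_apply, hn, smul_zero]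
  · refine h.right.mono ?_
    rintro γ ⟨γ₁, hγ⟩
    exact ⟨γ₁, fun hn => hγ (by rw [Pi.smul_apply, Pi.smul_apply, hn, smul_zero])⟩

lemma divPow_Dz1 {f : LogSeries₂ W} (h : HasBoundedSupport f) (j : ℕ) :
    HasBoundedSupport (divPow TwistedModules.Dz1 j f) := by
  have hpow : HasBoundedSupport ((TwistedModules.Dz1 ^ j) f) := by
    induction j with
    | zero => exact h
    | succ j ih =>
      rw [pow_succ', Module.End.mul_apply]
      exact ih.Dz1
  exact hpow.smul _

end HasBoundedSupport

end Bounded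

/-! ### Expansions of powers of `z₁₂` -/

section Iota

variable {W : Type*} [AddCommGroup W] [Module ℂ W]

lemma iota12_apply (n : ℤ) (f : LogSeries₂ W) (γ₁ γ₂ : ℂ) (k₁ k₂ : ℕ) :
    iota12 n f γ₁ γ₂ k₁ k₂ = altSum n fun i : ℕ => f (γ₁ - (n - i)) (γ₂ - i) k₁ k₂ := rfl

lemma iota21_apply (n : ℤ) (f : LogSeries₂ W) (γ₁ γ₂ : ℂ) (k₁ k₂ : ℕ) :
    iota21 n f γ₁ γ₂ k₁ k₂
      = (-1 : ℂ) ^ n • altSum n fun i : ℕ => f (γ₁ - i) (γ₂ - (n - i)) k₁ k₂ := by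
  rw [iota21, altSum, smul_finsum]
  refine finsum_congr fun i => ?_
  rw [smul_smul, zpow_add₀ (by norm_num), zpow_natCast, mul_assoc]

lemma iota12_mulZ12 (n : ℤ) {f : LogSeries₂ W} (h : IsBoundedBelow (support₂ f)) :
    iota12 n (mulZ12 f) = iota12 (n + 1) f := by
  funext γ₁ γ₂ k₁ k₂
  obtain ⟨M, hM⟩ := h.exists_forall_sub_notMem γ₂
  rw [iota12_apply, iota12_apply, ← altSum_sub_succ n (M := M)
    fun i hi => by rw [eq_zero_right (hM i hi)]; rfl]
  congr 1
  funext i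
  rw [mulZ12_apply]
  push_cast
  congr 2 <;> ring_nf

lemma iota21_mulZ12 (n : ℤ) {f : LogSeries₂ W} (h : IsBoundedBelow (Function.support f)) :
    iota21 n (mulZ12 f) = iota21 (n + 1) f := by
  funext γ₁ γ₂ k₁ k₂
  obtain ⟨M, hM⟩ := h.exists_forall_sub_notMem γ₁
  rw [iota21_apply, iota21_apply, ← altSum_sub_succ n (M := M)
    fun i hi => by rw [eq_zero_left (hM i hi)]; rfl]
  rw [zpow_add₀ (by norm_num), zpow_one, mul_smul]
  congr 1
  rw [← altSum_smul]
  congr 1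
  funext i
  rw [mulZ12_apply, neg_one_smul, neg_sub]
  push_cast
  congr 2 <;> ring_nf

lemma iota12_mulZ12_pow (n : ℤ) {f : LogSeries₂ W} (h : IsBoundedBelow (support₂ f)) (N : ℕ) :
    iota12 n ((mulZ12 ^ N) f) = iota12 (n + N) f := by
  induction N generalizing n with
  | zero => simp
  | succ N ih =>
    rw [pow_succ', Module.End.mul_apply,
      iota12_mulZ12 n (isBoundedBelow_support₂_mulZ12_pow h N), ih]
    congr 1
    push_cast
    ring

lemma iota21_mulZ12_pow (n : ℤ) {f : LogSeries₂ W} (h : IsBoundedBelow (Function.support f))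
    (N : ℕ) : iota21 n ((mulZ12 ^ N) f) = iota21 (n + N) f := by
  induction N generalizing n with
  | zero => simp
  | succ N ih =>
    rw [pow_succ', Module.End.mul_apply,
      iota21_mulZ12 n (isBoundedBelow_support_mulZ12_pow h N), ih]
    congr 1
    push_cast
    ring

lemma altSum_zero (u : ℕ → W) : altSum 0 u = u 0 := by
  rw [altSum, finsum_eq_single _ 0]
  · simp
  · intro i hi
    rw [Int.cast_zero, Ring.choose_zero_pos ℂ (Nat.pos_of_ne_zero hi)]
    simp

lemma iota12_zero (f : LogSeries₂ W) : iota12 0 f = f := by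
  funext γ₁ γ₂ k₁ k₂
  rw [iota12_apply, altSum_zero]
  simp

lemma iota21_zero (f : LogSeries₂ W) : iota21 0 f = f := by
  funext γ₁ γ₂ k₁ k₂
  rw [iota21_apply, altSum_zero]
  simp

lemma Dz1_iota12 (n : ℤ) {f : LogSeries₂ W} (h : IsBoundedBelow (support₂ f)) :
    Dz1 (iota12 n f) = iota12 n (Dz1 f) + (n : ℂ) • iota12 (n - 1) f := by
  funext γ₁ γ₂ k₁ k₂
  obtain ⟨M, hM⟩ := h.exists_forall_sub_notMem γ₂
  have hz : ∀ (i : ℕ), M ≤ i → ∀ γ k l, f γ (γ₂ - i) k l = 0 := fun i hi γ k l => by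
    rw [eq_zero_right (hM i hi)]; rfl
  have e : ∀ i : ℕ, γ₁ - ((n : ℂ) - i) + 1 = γ₁ + 1 - (n - i) := fun i => by ring
  have e' : ∀ i : ℕ, γ₁ - (((n - 1 : ℤ) : ℂ) - i) = γ₁ + 1 - (n - i) := fun i => by
    push_cast; ring
  simp only [Pi.add_apply, Pi.smul_apply, Dz1_apply, iota12_apply, e, e']
  rw [← altSum_sub_smul, ← altSum_smul, ← altSum_smul,
    ← altSum_add n (M := M) (fun i hi => by rw [hz i hi, smul_zero])
      (fun i hi => by rw [hz i hi, smul_zero]),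
    ← altSum_add n (M := M) (fun i hi => by rw [hz i hi, hz i hi, smul_zero, smul_zero, add_zero])
      (fun i hi => by rw [hz i hi, smul_zero])]
  congr 1
  funext i
  module

lemma Dz1_iota21 (n : ℤ) {f : LogSeries₂ W} (h : IsBoundedBelow (Function.support f)) :
    Dz1 (iota21 n f) = iota21 n (Dz1 f) + (n : ℂ) • iota21 (n - 1) f := by
  funext γ₁ γ₂ k₁ k₂
  obtain ⟨M, hM⟩ := h.exists_forall_sub_notMem (γ₁ + 1)
  have hz : ∀ (i : ℕ), M ≤ i → ∀ γ k l, f (γ₁ + 1 - i) γ k l = 0 := fun i hi γ k l => by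
    rw [eq_zero_left (hM i hi)]; rfl
  have e : ∀ i : ℕ, γ₁ - (i : ℂ) + 1 = γ₁ + 1 - i := fun i => by ring
  have e' : (n : ℂ) • altSum (n - 1)
        (fun i : ℕ => f (γ₁ - i) (γ₂ - (((n - 1 : ℤ) : ℂ) - i)) k₁ k₂)
      = -altSum n (fun i : ℕ => (i : ℂ) • f (γ₁ + 1 - i) (γ₂ - (n - i)) k₁ k₂) := by
    rw [altSum_natCast_smul n (M := M) fun i hi => hz i hi _ _ _, neg_neg]
    congr 2
    funext i
    rw [show γ₁ + 1 - ((i + 1 : ℕ) : ℂ) = γ₁ - i by push_cast; ring,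
      show γ₂ - ((n : ℂ) - ((i + 1 : ℕ) : ℂ)) = γ₂ - (((n - 1 : ℤ) : ℂ) - i) by push_cast; ring]
  simp only [Pi.add_apply, Pi.smul_apply, Dz1_apply, iota21_apply, e]
  rw [smul_comm (n : ℂ), e', zpow_sub_one₀ (by norm_num), inv_neg_one, mul_neg_one, neg_smul,
    smul_neg, neg_neg, smul_comm _ ((-1 : ℂ) ^ n), smul_comm _ ((-1 : ℂ) ^ n), ← smul_add,
    ← smul_add]
  congr 1
  rw [← altSum_smul, ← altSum_smul,
    ← altSum_add n (M := M) (fun i hi => by rw [hz i hi, smul_zero])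
      (fun i hi => by rw [hz i hi, smul_zero]),
    ← altSum_add n (M := M) (fun i hi => by rw [hz i hi, hz i hi, smul_zero, smul_zero, add_zero])
      (fun i hi => by rw [hz i hi, smul_zero])]
  congr 1
  funext i
  module

/-- The series `(ι_{z₁,z₂} z₁₂^n - ι_{z₂,z₁} z₁₂^n) f(z₁, z₂)`. For `n < 0` the factor is a
derivative of the formal delta function. -/
noncomputable def iotaDiff (n : ℤ) (f : LogSeries₂ W) : LogSeries₂ W := iota12 n f - iota21 n f

lemma Dz1_iotaDiff (n : ℤ) {f : LogSeries₂ W} (h : HasBoundedSupport f) :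
    Dz1 (iotaDiff n f) = iotaDiff n (Dz1 f) + (n : ℂ) • iotaDiff (n - 1) f := by
  rw [iotaDiff, map_sub, Dz1_iota12 n h.right, Dz1_iota21 n h.left, iotaDiff, iotaDiff, smul_sub]
  abel

lemma iota12_smul (n : ℤ) (c : ℂ) (f : LogSeries₂ W) : iota12 n (c • f) = c • iota12 n f := by
  funext γ₁ γ₂ k₁ k₂
  exact altSum_smul n c _

lemma iota21_smul (n : ℤ) (c : ℂ) (f : LogSeries₂ W) : iota21 n (c • f) = c • iota21 n f := by
  funext γ₁ γ₂ k₁ k₂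
  simp only [Pi.smul_apply, iota21_apply]
  rw [altSum_smul, smul_comm]

lemma iotaDiff_smul (n : ℤ) (c : ℂ) (f : LogSeries₂ W) :
    iotaDiff n (c • f) = c • iotaDiff n f := by
  rw [iotaDiff, iota12_smul, iota21_smul, ← smul_sub, iotaDiff]

lemma altSum_neg_one (u : ℕ → W) : altSum (-1) u = ∑ᶠ i, u i := by
  refine finsum_congr fun i => ?_
  have h : Ring.choose (-1 : ℂ) i = (-1) ^ i := by
    induction i with
    | zero => simp
    | succ i ih =>
      have h0 := Ring.choose_succ_succ (-1 : ℂ) i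
      rw [neg_add_cancel, Ring.choose_zero_succ, ih] at h0
      rw [pow_succ]
      linear_combination -h0
  rw [Int.cast_neg, Int.cast_one, h, ← mul_pow, neg_one_mul, neg_neg, one_pow, one_smul]

/-- Multiplication by the formal delta function sums a series over the lines of constant total
exponent. -/
lemma iotaDiff_neg_one_apply {f : LogSeries₂ W} (h : HasBoundedSupport f) (γ₁ γ₂ : ℂ)
    (k₁ k₂ : ℕ) : iotaDiff (-1) f γ₁ γ₂ k₁ k₂
      = ∑ᶠ j : ℤ, f (γ₁ + 1 + j) (γ₂ - j) k₁ k₂ := by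
  have hfin : (Function.support fun j : ℤ => f (γ₁ + 1 + j) (γ₂ - j) k₁ k₂).Finite := by
    have hinj : Function.Injective fun j : ℤ => γ₁ + 1 + (j : ℂ) := fun i j hij =>
      Int.cast_injective (add_left_cancel hij)
    refine ((h.left.finite_inter h.right (γ₁ + 1 + γ₂)).preimage hinj.injOn).subset fun j hj => ?_
    have hj' : f (γ₁ + 1 + j) (γ₂ - j) ≠ 0 := fun h0 => hj (by simp only [h0]; rfl)
    refine ⟨fun h0 => hj' (by rw [h0]; rfl), γ₁ + 1 + j, ?_⟩
    rwa [show γ₁ + 1 + γ₂ - (γ₁ + 1 + (j : ℂ)) = γ₂ - j by ring]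
  have hcov : (Set.univ : Set ℤ) = Set.range Int.ofNat ∪ Set.range Int.negSucc := by
    ext j
    cases j <;> simp
  have hdisj : Disjoint (Set.range Int.ofNat) (Set.range Int.negSucc) := by
    rw [Set.disjoint_left]
    rintro _ ⟨i, rfl⟩ ⟨j, hj⟩
    cases hj
  rw [← finsum_mem_univ, hcov, finsum_mem_union' hdisj (hfin.inter_of_right _)
    (hfin.inter_of_right _), finsum_mem_range fun i j hij => Int.ofNat.inj hij,
    finsum_mem_range fun i j hij => Int.negSucc.inj hij]
  rw [iotaDiff, Pi.sub_apply, Pi.sub_apply, Pi.sub_apply, Pi.sub_apply, iota12_apply,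
    iota21_apply, altSum_neg_one, altSum_neg_one, zpow_neg_one, inv_neg_one, neg_one_smul,
    sub_neg_eq_add]
  congr 1
  · refine finsum_congr fun i => ?_
    rw [show γ₁ - (((-1 : ℤ) : ℂ) - i) = γ₁ + 1 + ((Int.ofNat i : ℤ) : ℂ) by
      rw [Int.ofNat_eq_natCast]; push_cast; ring]
    rfl
  · refine finsum_congr fun i => ?_
    rw [Int.cast_negSucc, show γ₁ + 1 + -((i + 1 : ℕ) : ℂ) = γ₁ - i by push_cast; ring,
      show γ₂ - -((i + 1 : ℕ) : ℂ) = γ₂ - (((-1 : ℤ) : ℂ) - i) by push_cast; ring]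

end Iota

/-! ### Divided powers -/

section DividedPowers

variable {M : Type*} [AddCommGroup M] [Module ℂ M]

lemma divPow_zero (D : Module.End ℂ M) (x : M) : divPow D 0 x = x := by
  simp [divPow]

lemma apply_divPow (D : Module.End ℂ M) (j : ℕ) (x : M) :
    D (divPow D j x) = ((j : ℂ) + 1) • divPow D (j + 1) x := by
  have h1 : (j.factorial : ℂ) ≠ 0 := Nat.cast_ne_zero.2 j.factorial_ne_zero
  have h2 : (j : ℂ) + 1 ≠ 0 := Nat.cast_add_one_ne_zero j
  rw [divPow, divPow, LinearMap.smul_apply, LinearMap.smul_apply, map_smul, smul_smul, pow_succ',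
    Module.End.mul_apply, Nat.factorial_succ]
  congr 1
  push_cast
  field_simp

lemma apply_divPow_of_commute {D E : Module.End ℂ M} (h : Commute E D) (j : ℕ) (x : M) :
    E (divPow D j x) = divPow D j (E x) := by
  rw [divPow, LinearMap.smul_apply, LinearMap.smul_apply, map_smul, ← Module.End.mul_apply,
    (h.pow_right j).eq, Module.End.mul_apply]

lemma divPow_comm_apply (D : Module.End ℂ M) (j : ℕ) (x : M) :
    divPow D j (D x) = ((j : ℂ) + 1) • divPow D (j + 1) x := by
  rw [← apply_divPow_of_commute (Commute.refl D), apply_divPow]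

/-- The Leibniz rule for multiplication by a coordinate. -/
lemma divPow_succ_apply_of_commutator {D Z : Module.End ℂ M} (h : ∀ x, D (Z x) = Z (D x) + x)
    (j : ℕ) (x : M) : divPow D (j + 1) (Z x) = Z (divPow D (j + 1) x) + divPow D j x := by
  induction j with
  | zero => simp [divPow, h]
  | succ j ih =>
    have h2 : ((j + 1 : ℕ) : ℂ) + 1 ≠ 0 := Nat.cast_add_one_ne_zero (j + 1)
    refine smul_right_injective M h2 ?_
    simp only
    have hZ := congrArg Z (apply_divPow D (j + 1) x)
    rw [map_smul] at hZ
    rw [smul_add, ← hZ, ← apply_divPow, ih, map_add, h, apply_divPow D j]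
    push_cast
    module

end DividedPowers

/-! ### Restriction to the diagonal and `n`-th products of fields -/

section Diagonal

variable {W : Type*} [AddCommGroup W]

lemma diag_apply (f : LogSeries₂ W) (γ : ℂ) (k : ℕ) : diag f γ k = ∑ᶠ γ₁ : ℂ,
    ∑ p ∈ Finset.HasAntidiagonal.antidiagonal k, f γ₁ (γ - γ₁) p.1 p.2 := rfl

lemma HasBoundedSupport.finite_diag {f : LogSeries₂ W} (h : HasBoundedSupport f) (γ : ℂ)
    (k : ℕ) : (Function.support fun γ₁ : ℂ =>
      ∑ p ∈ Finset.HasAntidiagonal.antidiagonal k, f γ₁ (γ - γ₁) p.1 p.2).Finite := by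
  refine (h.left.finite_inter h.right γ).subset fun x hx => ?_
  have hx' : f x (γ - x) ≠ 0 := fun h0 => hx (Finset.sum_eq_zero fun p _ => by rw [h0]; rfl)
  exact ⟨fun h0 => hx' (by rw [h0]; rfl), x, hx'⟩

lemma diag_add {f g : LogSeries₂ W} (hf : HasBoundedSupport f) (hg : HasBoundedSupport g) :
    diag (f + g) = diag f + diag g := by
  funext γ k
  rw [Pi.add_apply, Pi.add_apply, diag_apply, diag_apply, diag_apply,
    ← finsum_add_distrib (hf.finite_diag γ k) (hg.finite_diag γ k)]
  exact finsum_congr fun x => Finset.sum_add_distrib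

variable [Module ℂ W]

lemma Dz1_mulZ12 (f : LogSeries₂ W) : Dz1 (mulZ12 f) = mulZ12 (Dz1 f) + f := by
  funext γ₁ γ₂ k₁ k₂
  simp only [Pi.add_apply, Dz1_apply, mulZ12_apply, add_sub_cancel_right, sub_add_cancel]
  module

lemma diag_mulZ12 {f : LogSeries₂ W} (h : HasBoundedSupport f) : diag (mulZ12 f) = 0 := by
  funext γ k
  have hfin := h.finite_diag (γ - 1) k
  set u : ℂ → W := fun x =>
    ∑ p ∈ Finset.HasAntidiagonal.antidiagonal k, f x (γ - 1 - x) p.1 p.2 with hu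
  have hshift : ∑ᶠ x, u (x - 1) = ∑ᶠ x, u x := finsum_comp_equiv (Equiv.subRight (1 : ℂ))
  have hfin' : (Function.support fun x => u (x - 1)).Finite :=
    hfin.preimage (sub_left_injective (b := (1 : ℂ))).injOn
  have : diag (mulZ12 f) γ k = ∑ᶠ x, (u (x - 1) - u x) := by
    rw [diag_apply]
    refine finsum_congr fun x => ?_
    rw [hu, ← Finset.sum_sub_distrib]
    refine Finset.sum_congr rfl fun p _ => ?_
    rw [mulZ12_apply, show γ - 1 - (x - 1) = γ - x by ring, show γ - x - 1 = γ - 1 - x by ring]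
  rw [this, finsum_sub_distrib hfin' hfin, hshift, sub_self]
  rfl

lemma isBoundedBelow_support_apply {a : W →ₗ[ℂ] LogSeries W} (ha : a ∈ LF W) (v : W) :
    IsBoundedBelow (Function.support (a v)) := by
  induction ha using Submodule.iSup_induction' with
  | mem α x hx =>
    obtain ⟨_, j, hj⟩ := hx v
    refine ⟨{-(α + j)}, fun γ hγ => ?_⟩
    obtain ⟨i, hi⟩ := hj γ hγ
    exact ⟨_, Finset.mem_singleton_self _, i, by rw [hi]; ring⟩
  | zero =>
    exact ⟨∅, fun γ hγ => absurd rfl hγ⟩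
  | add x y _ _ hx hy =>
    exact (hx.union hy).mono (Function.support_add _ _)

lemma isBoundedBelow_support₂_comp12 (a : W →ₗ[ℂ] LogSeries W) {b : W →ₗ[ℂ] LogSeries W}
    (hb : b ∈ LF W) (v : W) : IsBoundedBelow (support₂ (comp12 a b v)) := by
  refine (isBoundedBelow_support_apply hb v).mono ?_
  rintro γ₂ ⟨γ₁, h⟩ h0
  refine h ?_
  funext k₁ k₂
  simp only [comp12, h0, Pi.zero_apply, map_zero]

lemma isBoundedBelow_support_comp21 {a : W →ₗ[ℂ] LogSeries W} (b : W →ₗ[ℂ] LogSeries W)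
    (ha : a ∈ LF W) (v : W) : IsBoundedBelow (Function.support (comp21 a b v)) := by
  refine (isBoundedBelow_support_apply ha v).mono fun γ₁ h h0 => h ?_
  funext γ₂ k₁ k₂
  simp only [comp21, h0, Pi.zero_apply, map_zero]

/-- After multiplication by `z₁₂ ^ N`, locality makes `a(z₁) b(z₂) v` a series with exponents
bounded below in both variables. -/
lemma IsLocalOfOrder.hasBoundedSupport {a b : W →ₗ[ℂ] LogSeries W} {N : ℕ}
    (h : IsLocalOfOrder N a b) (ha : a ∈ LF W) (hb : b ∈ LF W) (v : W) :
    HasBoundedSupport ((mulZ12 ^ N) (comp12 a b v)) := by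
  refine ⟨?_, isBoundedBelow_support₂_mulZ12_pow (isBoundedBelow_support₂_comp12 a hb v) N⟩
  rw [h v]
  exact isBoundedBelow_support_mulZ12_pow (isBoundedBelow_support_comp21 b ha v) N

lemma IsLocalOfOrder.mono {a b : W →ₗ[ℂ] LogSeries W} {N M : ℕ} (h : IsLocalOfOrder N a b)
    (hNM : N ≤ M) : IsLocalOfOrder M a b := by
  intro v
  obtain ⟨d, rfl⟩ := Nat.exists_eq_add_of_le' hNM
  rw [pow_add, Module.End.mul_apply, Module.End.mul_apply, h v]

/-- The `n`-th product does not depend on the locality exponent: by the Leibniz rule the additional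
factor `z₁₂` either absorbs one derivative or vanishes on the diagonal. -/
lemma nthProductOfOrder_succ {a b : W →ₗ[ℂ] LogSeries W} {N : ℕ} (h : IsLocalOfOrder N a b)
    (ha : a ∈ LF W) (hb : b ∈ LF W) (n : ℤ) (v : W) :
    nthProductOfOrder (N + 1) a b n v = nthProductOfOrder N a b n v := by
  have hF := h.hasBoundedSupport ha hb v
  rw [nthProductOfOrder, nthProductOfOrder]
  rcases lt_trichotomy n (N : ℤ) with hn | hn | hn
  · have e1 : n ≤ ((N + 1 : ℕ) : ℤ) - 1 := by push_cast; omega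
    have e2 : n ≤ (N : ℤ) - 1 := by omega
    have e3 : (((N + 1 : ℕ) : ℤ) - 1 - n).toNat = ((N : ℤ) - 1 - n).toNat + 1 := by
      push_cast; omega
    rw [if_pos e1, if_pos e2, e3, pow_succ', Module.End.mul_apply,
      divPow_succ_apply_of_commutator Dz1_mulZ12,
      diag_add (by simpa using (hF.divPow_Dz1 _).mulZ12_pow 1) (hF.divPow_Dz1 _),
      diag_mulZ12 (hF.divPow_Dz1 _), zero_add]
  · subst hn
    have e1 : (N : ℤ) ≤ ((N + 1 : ℕ) : ℤ) - 1 := by push_cast; omega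
    have e3 : (((N + 1 : ℕ) : ℤ) - 1 - N).toNat = 0 := by push_cast; omega
    rw [if_pos e1, if_neg (by omega), e3, divPow_zero, pow_succ', Module.End.mul_apply,
      diag_mulZ12 hF]
  · rw [if_neg (by push_cast; omega), if_neg (by omega)]

lemma nthProductOfOrder_eq_of_le {a b : W →ₗ[ℂ] LogSeries W} {N M : ℕ}
    (h : IsLocalOfOrder N a b) (ha : a ∈ LF W) (hb : b ∈ LF W) (hNM : N ≤ M) (n : ℤ) (v : W) :
    nthProductOfOrder M a b n v = nthProductOfOrder N a b n v := by
  induction M, hNM using Nat.le_induction with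
  | base => rfl
  | succ M hM ih => rw [nthProductOfOrder_succ (h.mono hM) ha hb, ih]

lemma nthProduct_eq {a b : W →ₗ[ℂ] LogSeries W} {N : ℕ} (h : IsLocalOfOrder N a b)
    (ha : a ∈ LF W) (hb : b ∈ LF W) (n : ℤ) (v : W) :
    nthProduct a b n v = nthProductOfOrder N a b n v :=
  (nthProductOfOrder_eq_of_le (Nat.sInf_mem (s := {N : ℕ | IsLocalOfOrder N a b}) ⟨N, h⟩) ha hb
    (Nat.sInf_le h) n v).symm

lemma comp12_add (a a' b : W →ₗ[ℂ] LogSeries W) (v : W) :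
    comp12 (a + a') b v = comp12 a b v + comp12 a' b v := rfl

lemma comp21_add (a a' b : W →ₗ[ℂ] LogSeries W) (v : W) :
    comp21 (a + a') b v = comp21 a b v + comp21 a' b v := by
  funext γ₁ γ₂ k₁ k₂
  simp [comp21]

lemma IsLocalOfOrder.add {a a' b : W →ₗ[ℂ] LogSeries W} {N : ℕ} (h : IsLocalOfOrder N a b)
    (h' : IsLocalOfOrder N a' b) : IsLocalOfOrder N (a + a') b := by
  intro v
  rw [comp12_add, comp21_add, map_add, map_add, h v, h' v]

lemma nthProductOfOrder_add {a a' b : W →ₗ[ℂ] LogSeries W} {N : ℕ} (h : IsLocalOfOrder N a b)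
    (h' : IsLocalOfOrder N a' b) (ha : a ∈ LF W) (ha' : a' ∈ LF W) (hb : b ∈ LF W) (n : ℤ)
    (v : W) : nthProductOfOrder N (a + a') b n v
      = nthProductOfOrder N a b n v + nthProductOfOrder N a' b n v := by
  simp only [nthProductOfOrder]
  split_ifs
  · rw [comp12_add, map_add, map_add, diag_add ((h.hasBoundedSupport ha hb v).divPow_Dz1 _)
      ((h'.hasBoundedSupport ha' hb v).divPow_Dz1 _)]
  · rw [add_zero]

end Diagonal

/-! ### Sums along cosets of `ℤ` -/

section Cosets

variable {W : Type*} [AddCommGroup W]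

/-- If a finitely supported function on `ℂ` has sum `w` over the coset `-α + ℤ` and sum `0` over
every other coset of `ℤ`, then its total sum is `w`. -/
lemma finsum_eq_of_finsum_coset {g : ℂ → W} (hg : (Function.support g).Finite) (α : ℂ) (w : W)
    (hin : ∀ x : ℂ, (∃ j : ℤ, -x = α + j) → ∑ᶠ j : ℤ, g (x + j) = w)
    (hout : ∀ x : ℂ, (¬∃ j : ℤ, -x = α + j) → ∑ᶠ j : ℤ, g (x + j) = 0) :
    ∑ᶠ x, g x = w := by
  classical
  let π : ℂ → ℂ ⧸ AddSubgroup.zmultiples (1 : ℂ) := fun x => (x : ℂ ⧸ _)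
  have hπ : ∀ x y : ℂ, π x = π y ↔ ∃ j : ℤ, y = x + j := by
    intro x y
    change ((x : ℂ ⧸ AddSubgroup.zmultiples (1 : ℂ)) = y) ↔ _
    rw [QuotientAddGroup.eq, AddSubgroup.mem_zmultiples_iff]
    simp only [zsmul_one]
    exact ⟨fun ⟨j, hj⟩ => ⟨j, by rw [hj]; ring⟩, fun ⟨j, hj⟩ => ⟨j, by rw [hj]; ring⟩⟩
  have hfib : ∀ x, ∑ y ∈ hg.toFinset with π y = π x, g y = ∑ᶠ j : ℤ, g (x + j) := by
    intro x
    have hinj : Function.Injective fun j : ℤ => x + (j : ℂ) := fun i j hij =>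
      Int.cast_injective (add_left_cancel hij)
    rw [← finsum_mem_range (f := g) hinj]
    symm
    refine finsum_mem_eq_sum_of_inter_support_eq _ ?_
    ext y
    simp only [Set.mem_inter_iff, Set.mem_range, Finset.mem_coe, Finset.mem_filter,
      Set.Finite.mem_toFinset]
    rw [eq_comm (a := π y), hπ]
    constructor
    · rintro ⟨⟨j, hj⟩, hy⟩
      exact ⟨⟨hy, j, hj.symm⟩, hy⟩
    · rintro ⟨⟨hy, j, hj⟩, -⟩
      exact ⟨⟨j, hj.symm⟩, hy⟩
  have hsum : ∀ c, ∑ y ∈ hg.toFinset with π y = c, g y = if c = π (-α) then w else 0 := by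
    intro c
    obtain ⟨x, rfl⟩ := QuotientAddGroup.mk_surjective c
    have hiff : π x = π (-α) ↔ ∃ j : ℤ, -x = α + j := by
      rw [hπ]
      constructor
      · rintro ⟨j, hj⟩
        exact ⟨j, by linear_combination hj⟩
      · rintro ⟨j, hj⟩
        exact ⟨j, by linear_combination hj⟩
    change ∑ y ∈ hg.toFinset with π y = π x, g y = if π x = π (-α) then w else 0
    rw [hfib]
    split_ifs with h
    · exact hin x (hiff.1 h)
    · exact hout x (mt hiff.2 h)
  rw [finsum_eq_sum_of_support_toFinset_subset g hg (Finset.Subset.refl _),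
    ← Finset.sum_fiberwise_of_maps_to (t := insert (π (-α)) (hg.toFinset.image π)) (g := π)
      fun x hx => Finset.mem_insert_of_mem (Finset.mem_image_of_mem _ hx),
    Finset.sum_congr rfl fun c _ => hsum c, Finset.sum_ite_eq',
    if_pos (Finset.mem_insert_self _ _)]

end Cosets

/-! ### The shifted delta function -/

section Delta

variable {V : Type*} [AddCommGroup V] [Module ℂ V]

/-- Only monomials `z₁^γ₁ z₂^γ₂` with `γ₁ + γ₂ = c` occur. -/
def IsHomogeneous (c : ℂ) (s : LogSeries₂ V) : Prop :=
  ∀ γ₁ γ₂ : ℂ, γ₁ + γ₂ ≠ c → s γ₁ γ₂ = 0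

lemma IsHomogeneous.Dz1 {c : ℂ} {s : LogSeries₂ V} (h : IsHomogeneous c s) :
    IsHomogeneous (c - 1) (Dz1 s) := by
  intro γ₁ γ₂ hne
  funext k₁ k₂
  rw [Dz1_apply, h (γ₁ + 1) γ₂ fun h0 => hne (by linear_combination h0)]
  simp

lemma IsHomogeneous.Dz2 {c : ℂ} {s : LogSeries₂ V} (h : IsHomogeneous c s) :
    IsHomogeneous (c - 1) (Dz2 s) := by
  intro γ₁ γ₂ hne
  funext k₁ k₂
  rw [Dz2_apply, h γ₁ (γ₂ + 1) fun h0 => hne (by linear_combination h0)]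
  simp

lemma IsHomogeneous.smul {c : ℂ} {s : LogSeries₂ V} (h : IsHomogeneous c s) (r : ℂ) :
    IsHomogeneous c (r • s) := by
  intro γ₁ γ₂ hne
  rw [Pi.smul_apply, Pi.smul_apply, h γ₁ γ₂ hne, smul_zero]

lemma IsHomogeneous.divPow_Dz2 {c : ℂ} {s : LogSeries₂ V} (h : IsHomogeneous c s) (j : ℕ) :
    IsHomogeneous (c - j) (divPow TwistedModules.Dz2 j s) := by
  have hpow : IsHomogeneous (c - j) ((TwistedModules.Dz2 ^ j) s) := by
    induction j with
    | zero => simpa using h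
    | succ j ih =>
      rw [pow_succ', Module.End.mul_apply, Nat.cast_succ, ← sub_sub]
      exact ih.Dz2
  exact hpow.smul _

lemma shiftedDelta_of_mem (α : ℂ) (𝒩 : Module.End ℂ V) (a : V) {γ₁ γ₂ : ℂ}
    (h : ∃ j : ℤ, γ₂ = α + j) (h' : γ₁ = -γ₂ - 1) (k₁ k₂ : ℕ) :
    shiftedDelta α 𝒩 a γ₁ γ₂ k₁ k₂
      = ((-1 : ℂ) ^ k₁ / ((k₁.factorial : ℂ) * (k₂.factorial : ℂ))) • (𝒩 ^ (k₁ + k₂)) a := by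
  rw [shiftedDelta, if_pos ⟨h, h'⟩]

lemma shiftedDelta_of_not (α : ℂ) (𝒩 : Module.End ℂ V) (a : V) {γ₁ γ₂ : ℂ}
    (h : ¬((∃ j : ℤ, γ₂ = α + j) ∧ γ₁ = -γ₂ - 1)) (k₁ k₂ : ℕ) :
    shiftedDelta α 𝒩 a γ₁ γ₂ k₁ k₂ = 0 := by
  rw [shiftedDelta, if_neg h]

lemma isHomogeneous_shiftedDelta (α : ℂ) (𝒩 : Module.End ℂ V) (a : V) :
    IsHomogeneous (-1) (shiftedDelta α 𝒩 a) := by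
  intro γ₁ γ₂ hne
  funext k₁ k₂
  exact shiftedDelta_of_not α 𝒩 a (fun h => hne (by rw [h.2]; ring)) k₁ k₂

/-- `δ_{α+𝒩}` is annihilated by `D_{z₁} + D_{z₂}`. -/
lemma Dz1_shiftedDelta (α : ℂ) (𝒩 : Module.End ℂ V) (a : V) :
    Dz1 (shiftedDelta α 𝒩 a) = -Dz2 (shiftedDelta α 𝒩 a) := by
  funext γ₁ γ₂ k₁ k₂
  rw [Pi.neg_apply, Pi.neg_apply, Pi.neg_apply, Pi.neg_apply, Dz1_apply, Dz2_apply]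
  by_cases h : (∃ j : ℤ, γ₂ = α + j) ∧ γ₁ + 1 = -γ₂ - 1
  · obtain ⟨⟨j, hj⟩, h1⟩ := h
    have hj' : ∃ i : ℤ, γ₂ + 1 = α + i := ⟨j + 1, by rw [hj]; push_cast; ring⟩
    have h2 : γ₁ = -(γ₂ + 1) - 1 := by linear_combination h1
    rw [shiftedDelta_of_mem α 𝒩 a ⟨j, hj⟩ h1, shiftedDelta_of_mem α 𝒩 a ⟨j, hj⟩ h1,
      shiftedDelta_of_mem α 𝒩 a hj' h2, shiftedDelta_of_mem α 𝒩 a hj' h2,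
      show k₁ + 1 + k₂ = k₁ + (k₂ + 1) by omega, neg_add, ← neg_smul, smul_smul, smul_smul,
      smul_smul, ← neg_smul, smul_smul]
    have f1 : (k₁.factorial : ℂ) ≠ 0 := Nat.cast_ne_zero.2 k₁.factorial_ne_zero
    have f2 : (k₂.factorial : ℂ) ≠ 0 := Nat.cast_ne_zero.2 k₂.factorial_ne_zero
    have g1 : (k₁ : ℂ) + 1 ≠ 0 := Nat.cast_add_one_ne_zero k₁
    have g2 : (k₂ : ℂ) + 1 ≠ 0 := Nat.cast_add_one_ne_zero k₂
    congr 2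
    · rw [h2]
      ring
    · rw [Nat.factorial_succ, Nat.factorial_succ]
      push_cast
      field_simp
      ring
  · have h' : ¬((∃ j : ℤ, γ₂ + 1 = α + j) ∧ γ₁ = -(γ₂ + 1) - 1) := by
      rintro ⟨⟨j, hj⟩, h1⟩
      exact h ⟨⟨j - 1, by push_cast; linear_combination hj⟩, by linear_combination h1⟩
    simp only [shiftedDelta_of_not α 𝒩 a h, shiftedDelta_of_not α 𝒩 a h', smul_zero, add_zero,
      neg_zero]

lemma commute_Dz1_Dz2 : Commute (Dz1 : Module.End ℂ (LogSeries₂ V)) Dz2 := by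
  refine LinearMap.ext fun s => ?_
  funext γ₁ γ₂ k₁ k₂
  simp only [Module.End.mul_apply, Dz1_apply, Dz2_apply]
  module

lemma Dz1_divPow_Dz2_shiftedDelta (α : ℂ) (𝒩 : Module.End ℂ V) (a : V) (j : ℕ) :
    Dz1 (divPow Dz2 j (shiftedDelta α 𝒩 a))
      = (-((j : ℂ) + 1)) • divPow Dz2 (j + 1) (shiftedDelta α 𝒩 a) := by
  rw [apply_divPow_of_commute commute_Dz1_Dz2, Dz1_shiftedDelta, map_neg, divPow_comm_apply,
    neg_smul]

lemma divPow_Dz2_apply_mem {U : Submodule ℂ V} {s : LogSeries₂ V}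
    (hs : ∀ γ₁ γ₂ k₁ k₂, s γ₁ γ₂ k₁ k₂ ∈ U) (j : ℕ) :
    ∀ γ₁ γ₂ k₁ k₂, divPow Dz2 j s γ₁ γ₂ k₁ k₂ ∈ U := by
  have hpow : ∀ γ₁ γ₂ k₁ k₂, (Dz2 ^ j) s γ₁ γ₂ k₁ k₂ ∈ U := by
    induction j with
    | zero => exact hs
    | succ j ih =>
      intro γ₁ γ₂ k₁ k₂
      rw [pow_succ', Module.End.mul_apply, Dz2_apply]
      exact U.add_mem (U.smul_mem _ (ih _ _ _ _)) (U.smul_mem _ (ih _ _ _ _))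
  exact fun γ₁ γ₂ k₁ k₂ => U.smul_mem _ (hpow γ₁ γ₂ k₁ k₂)

lemma shiftedDelta_apply_mem {U : Submodule ℂ V} (α : ℂ) {𝒩 : Module.End ℂ V} {a : V}
    (h : ∀ l, (𝒩 ^ l) a ∈ U) (γ₁ γ₂ : ℂ) (k₁ k₂ : ℕ) :
    shiftedDelta α 𝒩 a γ₁ γ₂ k₁ k₂ ∈ U := by
  rw [shiftedDelta]
  split_ifs
  · exact U.smul_mem _ (h _)
  · exact U.zero_mem

end Delta

/-! ### Fields with series as arguments -/

section FieldOfSeries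

variable {V W : Type*} [AddCommGroup V] [Module ℂ V] [VertexAlgebra V]
  [AddCommGroup W] [Module ℂ W]

lemma fieldOfSeries_apply (Y : V →ₗ[ℂ] LF W) (n : ℤ) {c : ℂ} {s : LogSeries₂ V}
    (h : IsHomogeneous c s) (b : V) (v : W) (γ₁ γ₂ : ℂ) (k₁ k₂ : ℕ) :
    fieldOfSeries Y n s b v γ₁ γ₂ k₁ k₂
      = ∑ p ∈ Finset.HasAntidiagonal.antidiagonal k₂,
          (Y (VertexAlgebra.prod n (s γ₁ (c - γ₁) k₁ p.1) b)).1 v (γ₂ - (c - γ₁)) p.2 := by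
  rw [fieldOfSeries, finsum_eq_single _ (c - γ₁)]
  intro γ hγ
  refine Finset.sum_eq_zero fun p _ => ?_
  rw [h γ₁ γ fun h0 => hγ (by linear_combination h0)]
  simp

lemma fieldOfSeries_smul (Y : V →ₗ[ℂ] LF W) (n : ℤ) (r : ℂ) (s : LogSeries₂ V) (b : V) (v : W) :
    fieldOfSeries Y n (r • s) b v = r • fieldOfSeries Y n s b v := by
  funext γ₁ γ₂ k₁ k₂
  simp only [fieldOfSeries, Pi.smul_apply]
  rw [smul_finsum]
  refine finsum_congr fun γ => ?_
  rw [Finset.smul_sum]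
  refine Finset.sum_congr rfl fun p _ => ?_
  simp

lemma fieldOfSeries_eq_zero (Y : V →ₗ[ℂ] LF W) (n : ℤ) {s : LogSeries₂ V} {b : V}
    (h : ∀ γ₁ γ₂ k₁ k₂, VertexAlgebra.prod n (s γ₁ γ₂ k₁ k₂) b = 0) (v : W) :
    fieldOfSeries Y n s b v = 0 := by
  funext γ₁ γ₂ k₁ k₂
  simp only [fieldOfSeries, h, map_zero]
  simp

lemma Dz1_fieldOfSeries (Y : V →ₗ[ℂ] LF W) (n : ℤ) {c : ℂ} {s : LogSeries₂ V}
    (h : IsHomogeneous c s) (b : V) (v : W) :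
    Dz1 (fieldOfSeries Y n s b v) = fieldOfSeries Y n (Dz1 s) b v := by
  funext γ₁ γ₂ k₁ k₂
  rw [Dz1_apply, fieldOfSeries_apply Y n h, fieldOfSeries_apply Y n h,
    fieldOfSeries_apply Y n h.Dz1, Finset.smul_sum, Finset.smul_sum, ← Finset.sum_add_distrib]
  refine Finset.sum_congr rfl fun p _ => ?_
  rw [Dz1_apply, show c - 1 - γ₁ = c - (γ₁ + 1) by ring]
  simp

lemma Dz1_fieldOfSeries_shiftedDelta (Y : V →ₗ[ℂ] LF W) (n : ℤ) (α : ℂ) (𝒩 : Module.End ℂ V)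
    (a b : V) (v : W) (j : ℕ) :
    Dz1 (fieldOfSeries Y n (divPow Dz2 j (shiftedDelta α 𝒩 a)) b v)
      = (-((j : ℂ) + 1)) • fieldOfSeries Y n (divPow Dz2 (j + 1) (shiftedDelta α 𝒩 a)) b v := by
  rw [Dz1_fieldOfSeries Y n ((isHomogeneous_shiftedDelta α 𝒩 a).divPow_Dz2 j),
    Dz1_divPow_Dz2_shiftedDelta, fieldOfSeries_smul]

/-- Setting `ζ₁ = ζ₂` in `e^{(ζ₂ - ζ₁) 𝒩}` gives `1`; on coefficients this is
`∑ (-1)^p / (p! q!) = 0` over `p + q = s`, for `s > 0`. -/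
lemma sum_antidiagonal_neg_one_pow_div_factorial (s : ℕ) :
    ∑ p ∈ Finset.HasAntidiagonal.antidiagonal s,
        (-1 : ℂ) ^ p.1 / ((p.1.factorial : ℂ) * (p.2.factorial : ℂ))
      = if s = 0 then 1 else 0 := by
  have hs : (s.factorial : ℂ) ≠ 0 := Nat.cast_ne_zero.2 s.factorial_ne_zero
  have h := Commute.add_pow' (Commute.all (-1 : ℂ) 1) s
  have h2 : ∑ p ∈ Finset.HasAntidiagonal.antidiagonal s,
      (-1 : ℂ) ^ p.1 / ((p.1.factorial : ℂ) * (p.2.factorial : ℂ))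
        = (s.factorial : ℂ)⁻¹ * (-1 + 1 : ℂ) ^ s := by
    rw [h, Finset.mul_sum]
    refine Finset.sum_congr rfl fun p hp => ?_
    have hp' := Finset.HasAntidiagonal.mem_antidiagonal.1 hp
    have f1 : (p.1.factorial : ℂ) ≠ 0 := Nat.cast_ne_zero.2 p.1.factorial_ne_zero
    have f2 : (p.2.factorial : ℂ) ≠ 0 := Nat.cast_ne_zero.2 p.2.factorial_ne_zero
    have hc : (s.choose p.1 : ℂ) * p.1.factorial * p.2.factorial = s.factorial := by
      have := Nat.choose_mul_factorial_mul_factorial (n := s) (k := p.1) (by omega)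
      rw [show s - p.1 = p.2 by omega] at this
      exact_mod_cast this
    rw [nsmul_eq_mul, one_pow, mul_one, ← hc]
    have hch : (s.choose p.1 : ℂ) ≠ 0 := by
      intro h0
      rw [h0, zero_mul, zero_mul] at hc
      exact hs hc.symm
    field_simp
  rw [h2]
  split_ifs with h0
  · subst h0
    simp
  · rw [neg_add_cancel, zero_pow h0, mul_zero]

/-- Reassociation of a sum over triples with prescribed total. -/
lemma sum_antidiagonal_antidiagonal {M : Type*} [AddCommMonoid M] (f : ℕ → ℕ → ℕ → M) (k : ℕ) :
    ∑ p ∈ Finset.HasAntidiagonal.antidiagonal k,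
        ∑ q ∈ Finset.HasAntidiagonal.antidiagonal p.2, f p.1 q.1 q.2
      = ∑ p ∈ Finset.HasAntidiagonal.antidiagonal k,
        ∑ q ∈ Finset.HasAntidiagonal.antidiagonal p.1, f q.1 q.2 p.2 := by
  rw [Finset.sum_sigma', Finset.sum_sigma']
  refine Finset.sum_bij' (fun x _ => ⟨(x.1.1 + x.2.1, x.2.2), (x.1.1, x.2.1)⟩)
    (fun x _ => ⟨(x.2.1, x.2.2 + x.1.2), (x.2.2, x.1.2)⟩) ?_ ?_ ?_ ?_ ?_
  · rintro ⟨⟨a, b⟩, ⟨c, d⟩⟩ hx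
    simp only [Finset.mem_sigma, Finset.HasAntidiagonal.mem_antidiagonal] at hx ⊢
    exact ⟨by omega, trivial⟩
  · rintro ⟨⟨a, b⟩, ⟨c, d⟩⟩ hx
    simp only [Finset.mem_sigma, Finset.HasAntidiagonal.mem_antidiagonal] at hx ⊢
    exact ⟨by omega, trivial⟩
  · rintro ⟨⟨a, b⟩, ⟨c, d⟩⟩ hx
    simp only [Finset.mem_sigma, Finset.HasAntidiagonal.mem_antidiagonal] at hx
    obtain ⟨-, rfl⟩ := hx
    rfl
  · rintro ⟨⟨a, b⟩, ⟨c, d⟩⟩ hx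
    simp only [Finset.mem_sigma, Finset.HasAntidiagonal.mem_antidiagonal] at hx
    obtain ⟨-, rfl⟩ := hx
    rfl
  · rintro ⟨⟨a, b⟩, ⟨c, d⟩⟩ _
    rfl

/-- A series whose product with the formal delta function is `Y((δ_{α+𝒩} a)_(n) b, z₂) v` restricts
on the diagonal to `Y(a_(n) b, z) v`. -/
lemma diag_eq_of_iotaDiff_eq (Y : V →ₗ[ℂ] LF W) (n : ℤ) (α : ℂ) (𝒩 : Module.End ℂ V) (a b : V)
    (v : W) {G : LogSeries₂ W} (hG : HasBoundedSupport G)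
    (h : iotaDiff (-1) G = fieldOfSeries Y n (shiftedDelta α 𝒩 a) b v) :
    diag G = (Y (VertexAlgebra.prod n a b)).1 v := by
  funext γ k
  have hsum : ∀ x : ℂ, ∑ᶠ j : ℤ, ∑ p ∈ Finset.HasAntidiagonal.antidiagonal k,
      G (x + j) (γ - (x + j)) p.1 p.2
        = ∑ p ∈ Finset.HasAntidiagonal.antidiagonal k,
            ∑ q ∈ Finset.HasAntidiagonal.antidiagonal p.2,
          (Y (VertexAlgebra.prod n (shiftedDelta α 𝒩 a (x - 1) (-x) p.1 q.1) b)).1 v γ q.2 := by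
    intro x
    have hfin : ∀ p ∈ Finset.HasAntidiagonal.antidiagonal k,
        (Function.support fun j : ℤ => G (x + j) (γ - (x + j)) p.1 p.2).Finite := by
      intro p _
      have hinj : Function.Injective fun j : ℤ => x + (j : ℂ) := fun i j hij =>
        Int.cast_injective (add_left_cancel hij)
      refine ((hG.left.finite_inter hG.right γ).preimage hinj.injOn).subset fun j hj => ?_
      have hj' : G (x + j) (γ - (x + j)) ≠ 0 := fun h0 => hj (by simp only [h0]; rfl)
      exact ⟨fun h0 => hj' (by rw [h0]; rfl), x + j, hj'⟩
    rw [finsum_sum_comm _ _ hfin]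
    refine Finset.sum_congr rfl fun p _ => ?_
    have h1 := iotaDiff_neg_one_apply hG (x - 1) (γ - x) p.1 p.2
    rw [h, fieldOfSeries_apply Y n (isHomogeneous_shiftedDelta α 𝒩 a)] at h1
    simp only [sub_add_cancel, show (-1 : ℂ) - (x - 1) = -x by ring,
      show γ - x - -x = γ by ring] at h1
    rw [h1]
    refine finsum_congr fun j => ?_
    rw [sub_sub]
  rw [diag_apply]
  refine finsum_eq_of_finsum_coset (hG.finite_diag γ k) α _ (fun x hx => ?_) fun x hx => ?_
  · rw [hsum, sum_antidiagonal_antidiagonal (fun p q r =>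
      (Y (VertexAlgebra.prod n (shiftedDelta α 𝒩 a (x - 1) (-x) p q) b)).1 v γ r)]
    have hterm : ∀ p ∈ Finset.HasAntidiagonal.antidiagonal k,
        ∑ q ∈ Finset.HasAntidiagonal.antidiagonal p.1,
          (Y (VertexAlgebra.prod n (shiftedDelta α 𝒩 a (x - 1) (-x) q.1 q.2) b)).1 v γ p.2
        = (if p.1 = 0 then (1 : ℂ) else 0) •
            (Y (VertexAlgebra.prod n ((𝒩 ^ p.1) a) b)).1 v γ p.2 := by
      intro p _
      rw [← sum_antidiagonal_neg_one_pow_div_factorial, Finset.sum_smul]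
      refine Finset.sum_congr rfl fun q hq => ?_
      rw [shiftedDelta_of_mem α 𝒩 a hx (by ring), Finset.HasAntidiagonal.mem_antidiagonal.1 hq]
      simp
    rw [Finset.sum_congr rfl hterm, Finset.sum_eq_single (0, k)]
    · simp
    · rintro ⟨p, q⟩ hp hne
      have hp' := Finset.HasAntidiagonal.mem_antidiagonal.1 hp
      rw [if_neg, zero_smul]
      rintro rfl
      exact hne (by simpa using hp')
    · intro hk
      exact absurd (Finset.HasAntidiagonal.mem_antidiagonal.2 (zero_add k)) hk
  · rw [hsum]
    refine Finset.sum_eq_zero fun p _ => Finset.sum_eq_zero fun q _ => ?_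
    rw [shiftedDelta_of_not α 𝒩 a fun h0 => hx h0.1]
    simp

end FieldOfSeries

/-! ### Locality and the `n`-th product identity -/

section Main

/-- An inversion of the product rule: from the values of `iotaDiff (-1 - i) F` one finds those of
`iotaDiff (-1 - i) (D_{z₁}^{(k)} F)`. Here `T i k` stands for the latter and `S j m` for
`Y((D_{z₂}^{(j)} δ_{α+𝒩} a)_(m) b, z₂) v`. The case of interest is `i = 0`, where only the term
`S 0 (c - k)` is left. -/
lemma eq_sum_choose_smul {M : Type*} [AddCommGroup M] [Module ℂ M] (D : Module.End ℂ M)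
    (T : ℕ → ℕ → M) (S : ℕ → ℤ → M) (c : ℤ)
    (hT : ∀ i k : ℕ, ((k : ℂ) + 1) • T i (k + 1) = D (T i k) + ((i : ℂ) + 1) • T (i + 1) k)
    (hS : ∀ (j : ℕ) (m : ℤ), D (S j m) = (-((j : ℂ) + 1)) • S (j + 1) m)
    (h0 : ∀ i : ℕ, T i 0 = ∑ j ∈ Finset.range (i + 1), S j (c - i + j)) (k i : ℕ) :
    T i k = ∑ j ∈ Finset.range (i + 1), ((k + i - j).choose k : ℂ) • S j (c - k - i + j) := by
  induction k generalizing i with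
  | zero =>
    rw [h0]
    refine Finset.sum_congr rfl fun j _ => ?_
    simp
  | succ k ih =>
    have hk : (k : ℂ) + 1 ≠ 0 := Nat.cast_add_one_ne_zero k
    refine smul_right_injective M hk ?_
    simp only
    rw [hT, ih i, ih (i + 1), map_sum, Finset.smul_sum, Finset.smul_sum]
    -- `D` sends the `j`-th term of `T i k` to a multiple of `S (j + 1)`. After the shift of the
    -- index a term with `j = 0` may be included, its coefficient being zero, and the terms with
    -- `j = i + 1` of the two sums cancel.
    have e1 : ∑ j ∈ Finset.range (i + 1),
        D (((k + i - j).choose k : ℂ) • S j (c - k - i + j))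
          = ∑ j ∈ Finset.range (i + 2), (-(j : ℂ) * ((k + (i + 1) - j).choose k : ℂ)) •
              S j (c - k - (i + 1 : ℕ) + j) := by
      rw [Finset.sum_range_succ' _ (i + 1), Nat.cast_zero, neg_zero, zero_mul, zero_smul, add_zero]
      refine Finset.sum_congr rfl fun j _ => ?_
      rw [map_smul, hS, smul_smul, show k + (i + 1) - (j + 1) = k + i - j by omega,
        show c - k - (i + 1 : ℕ) + (j + 1 : ℕ) = c - k - i + j by push_cast; ring]
      congr 1
      push_cast
      ring
    rw [e1, ← Finset.sum_add_distrib, Finset.sum_range_succ]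
    have e2 : (-((i + 1 : ℕ) : ℂ) * ((k + (i + 1) - (i + 1)).choose k : ℂ)) •
          S (i + 1) (c - k - (i + 1 : ℕ) + (i + 1 : ℕ))
        + ((i : ℂ) + 1) • ((k + (i + 1) - (i + 1)).choose k : ℂ) •
          S (i + 1) (c - k - (i + 1 : ℕ) + (i + 1 : ℕ)) = 0 := by
      rw [smul_smul, ← add_smul]
      push_cast
      rw [show (-((i : ℂ) + 1) * ((k + (i + 1) - (i + 1)).choose k : ℂ)
        + ((i : ℂ) + 1) * ((k + (i + 1) - (i + 1)).choose k : ℂ)) = 0 by ring, zero_smul]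
    rw [e2, add_zero]
    refine Finset.sum_congr rfl fun j hj => ?_
    have hj' : j ≤ i := Nat.lt_succ_iff.1 (Finset.mem_range.1 hj)
    obtain ⟨d, rfl⟩ := Nat.exists_eq_add_of_le hj'
    rw [smul_smul, smul_smul, ← add_smul, show k + (j + d + 1) - j = k + d + 1 by omega,
      show k + 1 + (j + d) - j = k + d + 1 by omega,
      show c - k - (j + d + 1 : ℕ) + j = c - (k + 1 : ℕ) - (j + d : ℕ) + j by push_cast; ring]
    congr 1
    have := Nat.choose_succ_right_eq (k + d + 1) k
    rw [show k + d + 1 - k = d + 1 by omega] at this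
    have hc : ((k + d + 1).choose (k + 1) : ℂ) * (k + 1) = (k + d + 1).choose k * (d + 1) := by
      exact_mod_cast this
    push_cast
    linear_combination -hc

variable {V W : Type*} [AddCommGroup V] [Module ℂ V] [VertexAlgebra V]
  [AddCommGroup W] [Module ℂ W]

/-- The truncation bound may be chosen uniformly along the `𝒩`-orbit of a vector. -/
lemma exists_forall_prod_pow_eq_zero {𝒩 : Module.End ℂ V} (h𝒩 : IsLocallyNilpotent 𝒩) (a b : V) :
    ∃ N : ℕ, ∀ n : ℤ, (N : ℤ) ≤ n → ∀ l, VertexAlgebra.prod n ((𝒩 ^ l) a) b = 0 := by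
  obtain ⟨m, hm⟩ := h𝒩 a
  choose L hL using fun l : ℕ => VertexAlgebra.truncation ((𝒩 ^ l) a) b
  refine ⟨∑ l ∈ Finset.range m, (L l).toNat, fun n hn l => ?_⟩
  by_cases hl : l < m
  · refine hL l n ?_
    have := Finset.single_le_sum (f := fun l => (L l).toNat) (fun _ _ => Nat.zero_le _)
      (Finset.mem_range.2 hl)
    have h2 := Int.self_le_toNat (L l)
    omega
  · rw [pow_apply_eq_zero_of_le hm (not_lt.1 hl), map_zero, LinearMap.zero_apply]

lemma fieldOfSeries_shiftedDelta_eq_zero (Y : V →ₗ[ℂ] LF W) {𝒩 : Module.End ℂ V} {a b : V}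
    {n : ℤ} (h : ∀ l, VertexAlgebra.prod n ((𝒩 ^ l) a) b = 0) (α : ℂ) (j : ℕ) (v : W) :
    fieldOfSeries Y n (divPow Dz2 j (shiftedDelta α 𝒩 a)) b v = 0 := by
  refine fieldOfSeries_eq_zero Y n (fun γ₁ γ₂ k₁ k₂ => ?_) v
  have := divPow_Dz2_apply_mem (U := LinearMap.ker ((VertexAlgebra.prod n).flip b))
    (shiftedDelta_apply_mem α fun l => LinearMap.mem_ker.2 (h l)) j γ₁ γ₂ k₁ k₂
  exact LinearMap.mem_ker.1 this

section Homogeneous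

variable {σ 𝒩 : Module.End ℂ V} {Y : V →ₗ[ℂ] LF W} {α : ℂ} {a b : V} {N : ℕ}

/-- For `n ≥ N` the right-hand side of the Borcherds identity vanishes. -/
lemma isLocalOfOrder_of_borcherdsIdentity (hB : BorcherdsIdentity σ 𝒩 Y)
    (ha : a ∈ sigmaSpace σ α)
    (hN : ∀ n : ℤ, (N : ℤ) ≤ n → ∀ l, VertexAlgebra.prod n ((𝒩 ^ l) a) b = 0) :
    IsLocalOfOrder N (Y a).1 (Y b).1 := by
  intro v
  have h12 := iota12_mulZ12_pow 0 (isBoundedBelow_support₂_comp12 (Y a).1 (Y b).2 v) N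
  have h21 := iota21_mulZ12_pow 0 (isBoundedBelow_support_comp21 (Y b).1 (Y a).2 v) N
  rw [iota12_zero, zero_add] at h12
  rw [iota21_zero, zero_add] at h21
  rw [h12, h21]
  funext γ₁ γ₂ k₁ k₂
  refine sub_eq_zero.1 ((hB α a ha b v N γ₁ γ₂ k₁ k₂).trans ?_)
  have hz : ∀ j : ℕ, fieldOfSeries Y ((N : ℤ) + j) (divPow Dz2 j (shiftedDelta α 𝒩 a)) b v
      γ₁ γ₂ k₁ k₂ = 0 := fun j => by
    rw [fieldOfSeries_shiftedDelta_eq_zero Y (hN _ (by omega))]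
    rfl
  rw [finsum_congr hz, finsum_zero]

lemma iotaDiff_eq_sum_of_borcherdsIdentity (hB : BorcherdsIdentity σ 𝒩 Y)
    (ha : a ∈ sigmaSpace σ α)
    (hN : ∀ n : ℤ, (N : ℤ) ≤ n → ∀ l, VertexAlgebra.prod n ((𝒩 ^ l) a) b = 0) (v : W) (i : ℕ) :
    iotaDiff (-1 - i) ((mulZ12 ^ N) (comp12 (Y a).1 (Y b).1 v))
      = ∑ j ∈ Finset.range (i + 1),
          fieldOfSeries Y ((N : ℤ) - 1 - i + j) (divPow Dz2 j (shiftedDelta α 𝒩 a)) b v := by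
  have hloc := isLocalOfOrder_of_borcherdsIdentity hB ha hN
  have h21 := iota21_mulZ12_pow (-1 - i) (isBoundedBelow_support_comp21 (Y b).1 (Y a).2 v) N
  rw [← hloc v] at h21
  rw [iotaDiff, h21, iota12_mulZ12_pow _ (isBoundedBelow_support₂_comp12 (Y a).1 (Y b).2 v)]
  funext γ₁ γ₂ k₁ k₂
  rw [show (-1 - (i : ℤ) + N) = (N : ℤ) - 1 - i by ring]
  refine (hB α a ha b v _ γ₁ γ₂ k₁ k₂).trans ?_
  rw [finsum_eq_sum_range (M := i + 1) fun j hj => by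
    rw [fieldOfSeries_shiftedDelta_eq_zero Y (hN _ (by omega))]; rfl]
  simp only [Finset.sum_apply]

lemma eq_nthProductOfOrder_of_borcherdsIdentity (hB : BorcherdsIdentity σ 𝒩 Y)
    (ha : a ∈ sigmaSpace σ α)
    (hN : ∀ n : ℤ, (N : ℤ) ≤ n → ∀ l, VertexAlgebra.prod n ((𝒩 ^ l) a) b = 0) (n : ℤ) (v : W) :
    (Y (VertexAlgebra.prod n a b)).1 v = nthProductOfOrder N (Y a).1 (Y b).1 n v := by
  rw [nthProductOfOrder]
  split_ifs with hn
  · set F := (mulZ12 ^ N) (comp12 (Y a).1 (Y b).1 v) with hF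
    have hFb : HasBoundedSupport F :=
      (isLocalOfOrder_of_borcherdsIdentity hB ha hN).hasBoundedSupport (Y a).2 (Y b).2 v
    obtain ⟨k, hk⟩ := Int.eq_ofNat_of_zero_le (show 0 ≤ (N : ℤ) - 1 - n by omega)
    rw [hk, Int.toNat_natCast]
    refine (diag_eq_of_iotaDiff_eq Y n α 𝒩 a b v (hFb.divPow_Dz1 k) ?_).symm
    have key := eq_sum_choose_smul Dz1 (fun i k => iotaDiff (-1 - (i : ℤ)) (divPow Dz1 k F))
      (fun j m => fieldOfSeries Y m (divPow Dz2 j (shiftedDelta α 𝒩 a)) b v) ((N : ℤ) - 1)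
      (fun i k => ?_) (fun j m => Dz1_fieldOfSeries_shiftedDelta Y m α 𝒩 a b v j)
      (fun i => by rw [divPow_zero, iotaDiff_eq_sum_of_borcherdsIdentity hB ha hN]) k 0
    · have e : (N : ℤ) - 1 - k = n := by omega
      simpa [divPow_zero, e] using key
    · rw [Dz1_iotaDiff _ (hFb.divPow_Dz1 k), apply_divPow, iotaDiff_smul,
        show -1 - ((i + 1 : ℕ) : ℤ) = -1 - i - 1 by push_cast; ring]
      push_cast
      module
  · have h0 : VertexAlgebra.prod n a b = 0 := by simpa using hN n (by omega) 0
    rw [h0, map_zero]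
    rfl

end Homogeneous

/-- Both properties pass from the spaces `V_α` to their sum, since `N` may be enlarged to serve
finitely many components of `a` at once. -/
lemma exists_isLocalOfOrder_and_eq {σ 𝒩 : Module.End ℂ V} {Y : V →ₗ[ℂ] LF W}
    (hB : BorcherdsIdentity σ 𝒩 Y) (h𝒩 : IsLocallyNilpotent 𝒩)
    (htop : ⨆ α : ℂ, sigmaSpace σ α = ⊤) (a b : V) :
    ∃ N : ℕ, IsLocalOfOrder N (Y a).1 (Y b).1 ∧
      ∀ (n : ℤ) (v : W), (Y (VertexAlgebra.prod n a b)).1 v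
        = nthProductOfOrder N (Y a).1 (Y b).1 n v := by
  have ha : a ∈ ⨆ α : ℂ, sigmaSpace σ α := htop ▸ Submodule.mem_top
  induction ha using Submodule.iSup_induction' with
  | mem α x hx =>
    obtain ⟨N, hN⟩ := exists_forall_prod_pow_eq_zero h𝒩 x b
    exact ⟨N, isLocalOfOrder_of_borcherdsIdentity hB hx hN,
      eq_nthProductOfOrder_of_borcherdsIdentity hB hx hN⟩
  | zero =>
    obtain ⟨N, hN⟩ := exists_forall_prod_pow_eq_zero h𝒩 0 b
    have h0 : (0 : V) ∈ sigmaSpace σ 0 := Submodule.zero_mem _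
    exact ⟨N, isLocalOfOrder_of_borcherdsIdentity hB h0 hN,
      eq_nthProductOfOrder_of_borcherdsIdentity hB h0 hN⟩
  | add x y _ _ hx hy =>
    obtain ⟨N, hN, hxn⟩ := hx
    obtain ⟨M, hM, hyn⟩ := hy
    have hN' := hN.mono (le_max_left N M)
    have hM' := hM.mono (le_max_right N M)
    have hadd : (Y (x + y)).1 = (Y x).1 + (Y y).1 := by
      rw [map_add]
      rfl
    refine ⟨max N M, hadd ▸ hN'.add hM', fun n v => ?_⟩
    rw [hadd, nthProductOfOrder_add hN' hM' (Y x).2 (Y y).2 (Y b).2,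
      nthProductOfOrder_eq_of_le hN (Y x).2 (Y b).2 (le_max_left N M),
      nthProductOfOrder_eq_of_le hM (Y y).2 (Y b).2 (le_max_right N M), ← hxn, ← hyn, map_add,
      LinearMap.add_apply, map_add]
    rfl

end Main

end TwistedModules

theorem proposition5p3
    {V W : Type*} [AddCommGroup V] [Module ℂ V] [TwistedModules.VertexAlgebra V]
    [AddCommGroup W] [Module ℂ W]
    (φ : V ≃ₗ[ℂ] V) (hφ : TwistedModules.IsAutomorphism φ)
    (hfin : TwistedModules.IsLocallyFinite φ.toLinearMap)
    (Y : V →ₗ[ℂ] TwistedModules.LF W)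
    (hequiv : TwistedModules.IsEquivariant φ Y)
    (hborcherds : ∀ σ 𝒩 : Module.End ℂ V,
      TwistedModules.IsJordanDecomposition φ.toLinearMap σ 𝒩 →
        TwistedModules.BorcherdsIdentity σ 𝒩 Y) :
    TwistedModules.HasLocalImage Y ∧
      TwistedModules.NthProductIdentity Y ∧
      ((Y TwistedModules.VertexAlgebra.vac).1 = TwistedModules.idField W →
        TwistedModules.IsTwistedModule φ Y) := by
  obtain ⟨σ, 𝒩, hJ⟩ := TwistedModules.exists_isJordanDecomposition φ hfin
  have key := TwistedModules.exists_isLocalOfOrder_and_eq (hborcherds σ 𝒩 hJ)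
    hJ.locallyNilpotent (TwistedModules.iSup_sigmaSpace_eq_top hJ)
  have hloc : TwistedModules.HasLocalImage Y := by
    rintro _ ⟨a, rfl⟩ _ ⟨b, rfl⟩
    obtain ⟨N, hN, _⟩ := key a b
    exact ⟨N, hN⟩
  have hprod : TwistedModules.NthProductIdentity Y := by
    intro a b n v
    obtain ⟨N, hN, hn⟩ := key a b
    rw [TwistedModules.nthProduct_eq hN (Y a).2 (Y b).2, hn]
  exact ⟨hloc, hprod, fun hvac => ⟨hvac, hloc, hequiv, hprod⟩⟩
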